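/- Let $\mathbb K\in\{\mathbb R,\mathbb C\}$, let $V,H$ be separable Hilbert spaces over $\mathbb K$ with $V$ continuously and densely embedded in $H$, and let $V'$ be the antidual of $V$ (the dual if $\mathbb K=\mathbb R$). Identify $h\in H$ with the functional $v\mapsto (h\mid v)_H$ on $V$, so that $V\hookrightarrow H\hookrightarrow V'$. Let $T>0$ and let $\mathfrak a\colon[0,T]\times V\times V\to\mathbb K$ be sesquilinear in the last two variables, with $t\mapsto\mathfrak a(t,u,v)$ measurable for all $u,v\in V$. Suppose that there are constants $M,\dot M\ge 0$, $\alpha>0$ and $\omega\in\mathbb R$ such that for all $t,s\in[0,T]$ and $u,v\in V$: - ($V$-bounded) $|\mathfrak a(t,u,v)|\le M\|u\|_V\|v\|_V$; - (quasi-coercive) $\operatorname{Re}\mathfrak a(t,u,u)+\omega\|u\|_H^2\ge\alpha\|u\|_V^2$; - (symmetric) $\mathfrak a(t,u,v)=\overline{\mathfrak a(t,v,u)}$; - (Lipschitz) $|\mathfrak a(t,u,v)-\mathfrak a(s,u,v)|\le\dot M|t-s|\,\|u\|_V\|v\|_V$. Let $\mathcal A(t)\in\mathcal L(V,V')$ be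 given by $\langle\mathcal A(t)u,v\rangle=\mathfrak a(t,u,v)$. Then for every $u_0\in V$, $u_1\in H$ and $f\in L^2(0,T;H)$ there exists a unique $$u\in L^2(0,T;V)\cap H^1(0,T;H)\cap H^2(0,T;V')$$ such that $$\ddot u(t)+\mathcal A(t)u(t)=f(t)\ \text{ in } V' \text{ for a.e. } t\in(0,T),\qquad u(0)=u_0,\quad \dot u(0)=u_1,$$ where the initial values are taken for the continuous representatives $u\in C([0,T];H)$ and $\dot u\in C([0,T];V')$. Moreover, for this $u$, the continuous representative satisfies $u(t)\in V$ for all $t\in[0,T]$. -/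

import Mathlib

open MeasureTheory Set
open scoped ENNReal ContDiff ComplexConjugate

noncomputable section

namespace WaveMR

/-- The antidual `V'` of `V`: bounded antilinear functionals on `V` (the dual when `𝕜 = ℝ`),
with the operator norm. -/
abbrev AntiDual (𝕜 V : Type*) [RCLike 𝕜] [NormedAddCommGroup V] [InnerProductSpace 𝕜 V] :=
  V →L⋆[𝕜] 𝕜

/-- `L²(0,T;E)`. -/
abbrev L2 (T : ℝ) (E : Type*) [NormedAddCommGroup E] :=
  Lp E 2 (volume.restrict (Ioo (0 : ℝ) T))

section WeakDerivative

/-- `g'` is the weak derivative of `g` on `(0,T)`: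
`∫ φ' g = - ∫ φ g'` for all `φ ∈ C_c^∞(0,T)`. -/
def IsWeakDeriv {E : Type*} [NormedAddCommGroup E] [NormedSpace ℝ E] (T : ℝ) (g g' : ℝ → E) :
    Prop :=
  ∀ φ : ℝ → ℝ, ContDiff ℝ ∞ φ → HasCompactSupport φ → tsupport φ ⊆ Ioo 0 T →
    ∫ t in Ioo 0 T, deriv φ t • g t = - ∫ t in Ioo 0 T, φ t • g' t

/-- `U` is a representative of `g` (a function on `(0,T)` up to null sets) which is continuous
on `[0,T]`. -/
def IsContRep {E : Type*} [NormedAddCommGroup E] (T : ℝ) (g U : ℝ → E) : Prop :=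
  ContinuousOn U (Icc 0 T) ∧ U =ᵐ[volume.restrict (Ioo 0 T)] g

/-- `g(0) = x`, the value at `0` being that of the continuous representative of `g`. -/
def HasInitialValue {E : Type*} [NormedAddCommGroup E] (T : ℝ) (g : ℝ → E) (x : E) : Prop :=
  ∃ U : ℝ → E, IsContRep T g U ∧ U 0 = x

end WeakDerivative

section Forms

variable {𝕜 V H : Type*} [RCLike 𝕜] [NormedAddCommGroup V] [InnerProductSpace 𝕜 V]
  [NormedAddCommGroup H] [InnerProductSpace 𝕜 H]

/-- The embedding `H → V'` induced by `j : V → H`: `h ↦ (v ↦ (h | v)_H)`. (The scalar product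
`(h | v)_H`, linear in `h`, is `inner 𝕜 v h` in Mathlib.) -/
def toAntiDual (j : V →L[𝕜] H) (h : H) : AntiDual 𝕜 V :=
  (innerSLFlip 𝕜 h).comp j

theorem toAntiDual_apply (j : V →L[𝕜] H) (h : H) (v : V) :
    toAntiDual j h v = inner 𝕜 (j v) h := rfl

variable {T : ℝ}

/-- `V`-bounded non-autonomous sesquilinear form: uniformly bounded in `t ∈ [0,T]`, and
measurable in `t`. (Sesquilinearity is part of the type of `a`.) -/
structure IsVBounded (a : Icc (0 : ℝ) T → V →ₗ[𝕜] V →ₗ⋆[𝕜] 𝕜) : Prop where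
  bound : ∃ M : ℝ, ∀ (t : Icc (0 : ℝ) T) (u v : V), ‖a t u v‖ ≤ M * ‖u‖ * ‖v‖
  meas : ∀ u v : V, Measurable fun t : Icc (0 : ℝ) T => a t u v

/-- Quasi-coercivity with respect to `j : V → H`. -/
def IsQuasiCoercive (j : V →L[𝕜] H) (a : Icc (0 : ℝ) T → V →ₗ[𝕜] V →ₗ⋆[𝕜] 𝕜) : Prop :=
  ∃ α : ℝ, 0 < α ∧ ∃ w : ℝ, ∀ (t : Icc (0 : ℝ) T) (u : V),
    α * ‖u‖ ^ 2 ≤ RCLike.re (a t u u) + w * ‖j u‖ ^ 2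

def IsSymmetricForm (a : Icc (0 : ℝ) T → V →ₗ[𝕜] V →ₗ⋆[𝕜] 𝕜) : Prop :=
  ∀ (t : Icc (0 : ℝ) T) (u v : V), a t u v = conj (a t v u)

def IsLipschitzForm (a : Icc (0 : ℝ) T → V →ₗ[𝕜] V →ₗ⋆[𝕜] 𝕜) : Prop :=
  ∃ L : ℝ, ∀ (t s : Icc (0 : ℝ) T) (u v : V),
    ‖a t u v - a s u v‖ ≤ L * |(t : ℝ) - s| * ‖u‖ * ‖v‖

/-- The operator `𝒜(t) ∈ ℒ(V,V')` associated with the form: `⟨𝒜(t)u, v⟩ = a(t,u,v)`. -/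
def formOp {a : Icc (0 : ℝ) T → V →ₗ[𝕜] V →ₗ⋆[𝕜] 𝕜} (ha : IsVBounded a)
    (t : Icc (0 : ℝ) T) : V →L[𝕜] AntiDual 𝕜 V :=
  (a t).mkContinuous₂ ha.bound.choose (ha.bound.choose_spec t)

theorem formOp_apply {a : Icc (0 : ℝ) T → V →ₗ[𝕜] V →ₗ⋆[𝕜] 𝕜} (ha : IsVBounded a)
    (t : Icc (0 : ℝ) T) (u v : V) : formOp ha t u v = a t u v := rfl

/-- `u` belongs to `MR(V,H,V') = L²(0,T;V) ∩ H¹(0,T;H) ∩ H²(0,T;V')`, with first and second weak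
derivatives `u'` and `u''`; `V ⊆ H ⊆ V'` via `j` and `toAntiDual j`. -/
structure HasMRDerivs (j : V →L[𝕜] H) (u : L2 T V) (u' : L2 T H) (u'' : L2 T (AntiDual 𝕜 V)) :
    Prop where
  first : letI : NormedSpace ℝ H := NormedSpace.restrictScalars ℝ 𝕜 H
    IsWeakDeriv T (fun t => j (u t)) u'
  second : IsWeakDeriv T (fun t => toAntiDual j (u' t)) u''

/-- `u ∈ MR(V,H,V')` solves `ü + 𝒜(t)u = f` in `V'` for a.e. `t ∈ (0,T)`, and `u(0) = u₀`,
`u̇(0) = u₁`. The initial values are those of the continuous representatives of `u` in `H` and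
of `u̇` in `V'`. -/
def IsWaveSolution (j : V →L[𝕜] H) {a : Icc (0 : ℝ) T → V →ₗ[𝕜] V →ₗ⋆[𝕜] 𝕜}
    (ha : IsVBounded a) (f : L2 T H) (u₀ : V) (u₁ : H) (u : L2 T V) : Prop :=
  ∃ (u' : L2 T H) (u'' : L2 T (AntiDual 𝕜 V)), HasMRDerivs j u u' u'' ∧
    (∀ᵐ t : ℝ, ∀ ht : t ∈ Ioo 0 T,
      u'' t + formOp ha ⟨t, Ioo_subset_Icc_self ht⟩ (u t) = toAntiDual j (f t)) ∧
    HasInitialValue T (fun t => j (u t)) (j u₀) ∧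
    HasInitialValue T (fun t => toAntiDual j (u' t)) (toAntiDual j u₁)

end Forms

end WaveMR

end

set_option linter.unusedSectionVars false

/-! The scalar field is reduced to `ℝ` by taking real parts of the inner products. Riesz
representation replaces `V'` by `V`: the form becomes a Lipschitz family `A t` of symmetric
operators on `V`, and `H → V'` becomes `j.adjoint`. Since functions with integrable weak derivatives
are primitives, being a solution amounts to two integrated identities, `j u = j u₀ + ∫ p` and `j* p
= j* u₁ + ∫ (j* f - A u)` (`IsMildSolution`).

The natural multiplier `u̇` is only `H`-valued, so the equation cannot be tested with it directly.
For uniqueness (`IsMildSolution.ae_eq_zero`) the homogeneous equation is tested with a weighted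
antiderivative of `u` vanishing at `T`; an exponential weight absorbs the Lipschitz and lower order
terms. For existence (`exists_variational_solution`) the equation is tested with `exp (-lam t) w'`
for smooth `w` with `w' T = 0`. The resulting bilinear form is coercive (`energy_coercive`), and
Lions' representation theorem gives a solution. Both estimates rest on `energy_le`, which bounds
increments of `θ ⟪B w, w⟫` for `B` merely Lipschitz in time.

The traces `w 0` and `w T` are kept as `V`-valued components of the Hilbert space. The coercivity
controls them, so the constructed solution carries a terminal value `y` in `V`. Solving on `[0,s]`
and using uniqueness there shows that the continuous representative has value in `V` at every `s`.
-/

namespace WaveMR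

/-! ### Absolute continuity and integration by parts for vector-valued primitives. -/

section AbsolutelyContinuous

open Filter Topology

variable {E F G : Type*} [NormedAddCommGroup E] [NormedSpace ℝ E]
  [NormedAddCommGroup F] [NormedSpace ℝ F] [NormedAddCommGroup G] [NormedSpace ℝ G]

/-- A function whose increments are bounded by those of an indefinite integral is absolutely
continuous. -/
theorem absolutelyContinuousOnInterval_of_dist_le {w : ℝ → E} {h : ℝ → ℝ} {a b : ℝ} (hab : a ≤ b)
    (hh : IntervalIntegrable h volume a b)
    (hw : ∀ x ∈ Icc a b, ∀ y ∈ Icc a b, x ≤ y → dist (w x) (w y) ≤ ∫ t in x..y, h t) :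
    AbsolutelyContinuousOnInterval w a b := by
  have hac := hh.absolutelyContinuousOnInterval_intervalIntegral (c := a) left_mem_uIcc
  -- Increments of `w` are dominated by those of the scalar primitive of `h`, so its absolute
  -- continuity passes to `w` by squeezing the sums.
  have key : ∀ x ∈ Icc a b, ∀ y ∈ Icc a b, dist (w x) (w y) ≤
      dist (∫ t in a..x, h t) (∫ t in a..y, h t) := by
    have hle : ∀ x ∈ Icc a b, ∀ y ∈ Icc a b, x ≤ y → dist (w x) (w y) ≤
        dist (∫ t in a..x, h t) (∫ t in a..y, h t) := by
      intro x hx y hy hxy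
      refine (hw x hx y hy hxy).trans ?_
      rw [dist_comm, Real.dist_eq, intervalIntegral.integral_interval_sub_left]
      · exact le_abs_self _
      · exact hh.mono_set (by rw [uIcc_of_le hy.1, uIcc_of_le hab]; exact Icc_subset_Icc_right hy.2)
      · exact hh.mono_set (by rw [uIcc_of_le hx.1, uIcc_of_le hab]; exact Icc_subset_Icc_right hx.2)
    intro x hx y hy
    rcases le_total x y with hxy | hxy
    · exact hle x hx y hy hxy
    · rw [dist_comm (w x), dist_comm (∫ t in a..x, h t)]
      exact hle y hy x hx hxy
  refine squeeze_zero' (Eventually.of_forall fun _ => Finset.sum_nonneg fun _ _ => dist_nonneg)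
    ?_ hac
  have : ∀ᶠ I : ℕ × (ℕ → ℝ × ℝ) in AbsolutelyContinuousOnInterval.totalLengthFilter ⊓
      𝓟 (AbsolutelyContinuousOnInterval.disjWithin a b),
      I ∈ AbsolutelyContinuousOnInterval.disjWithin a b := eventually_inf_principal.mpr (by simp)
  filter_upwards [this] with I hI
  refine Finset.sum_le_sum fun i hi => ?_
  have h1 := hI.1 i hi
  rw [uIcc_of_le hab] at h1
  exact key _ h1.1 _ h1.2

theorem IntervalIntegrable.mono_Icc {v : ℝ → E} {a b x y : ℝ} (hab : a ≤ b)
    (hv : IntervalIntegrable v volume a b) (hx : x ∈ Icc a b) (hy : y ∈ Icc a b) :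
    IntervalIntegrable v volume x y :=
  hv.mono_set (by rw [uIcc_of_le hab]; exact uIcc_subset_Icc hx hy)

/-- Fundamental theorem of calculus for vector-valued functions with integrably bounded
increments. -/
theorem integral_eq_sub_of_dist_le [CompleteSpace E] {w w' : ℝ → E} {h : ℝ → ℝ} {a b : ℝ}
    (hab : a ≤ b)
    (hh : IntervalIntegrable h volume a b)
    (hw : ∀ x ∈ Icc a b, ∀ y ∈ Icc a b, x ≤ y → dist (w x) (w y) ≤ ∫ t in x..y, h t)
    (hw' : IntervalIntegrable w' volume a b)
    (hd : ∀ᵐ t, t ∈ uIcc a b → HasDerivAt w (w' t) t) :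
    ∫ t in a..b, w' t = w b - w a := by
  -- The difference of `w` and the primitive of `w'` is absolutely continuous with a.e. zero
  -- derivative, hence constant.
  have hg : AbsolutelyContinuousOnInterval (fun x => w x - ∫ t in a..x, w' t) a b := by
    refine absolutelyContinuousOnInterval_of_dist_le (h := fun t => h t + ‖w' t‖) hab
      (hh.add hw'.norm) fun x hx y hy hxy => ?_
    have hI := IntervalIntegrable.mono_Icc hab hw' hx hy
    rw [intervalIntegral.integral_add (IntervalIntegrable.mono_Icc hab hh hx hy) hI.norm]
    refine (dist_sub_sub_le _ _ _ _).trans (add_le_add (hw x hx y hy hxy) ?_)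
    rw [dist_comm, dist_eq_norm, intervalIntegral.integral_interval_sub_left]
    · exact intervalIntegral.norm_integral_le_integral_norm hxy
    · exact IntervalIntegrable.mono_Icc hab hw' (left_mem_Icc.2 hab) hy
    · exact IntervalIntegrable.mono_Icc hab hw' (left_mem_Icc.2 hab) hx
  obtain ⟨C, hC⟩ := hg.const_of_ae_hasDerivAt_zero (by
    filter_upwards [hd, hw'.ae_hasDerivAt_integral] with x h1 h2 hx
    simpa using (h1 hx).fun_sub (h2 hx a left_mem_uIcc))
  have h1 := hC a left_mem_uIcc
  have h2 := hC b right_mem_uIcc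
  simp only [intervalIntegral.integral_same, sub_zero] at h1
  rw [h1, ← h2]
  abel

theorem continuousOn_primitive_Icc {v : ℝ → E} {T : ℝ} (hT : 0 ≤ T)
    (hv : IntervalIntegrable v volume 0 T) (c : E) :
    ContinuousOn (fun t => c + ∫ s in (0 : ℝ)..t, v s) (Icc 0 T) := by
  refine continuousOn_const.add ?_
  have := intervalIntegral.continuousOn_primitive_interval' hv left_mem_uIcc
  rwa [uIcc_of_le hT] at this

theorem dist_primitive_le {v : ℝ → E} {T : ℝ} (hT : 0 ≤ T)
    (hv : IntervalIntegrable v volume 0 T) (c : E) {x y : ℝ} (hx : x ∈ Icc 0 T) (hy : y ∈ Icc 0 T)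
    (hxy : x ≤ y) :
    dist (c + ∫ s in (0 : ℝ)..x, v s) (c + ∫ s in (0 : ℝ)..y, v s) ≤ ∫ s in x..y, ‖v s‖ := by
  rw [dist_comm, dist_eq_norm, add_sub_add_left_eq_sub,
    intervalIntegral.integral_interval_sub_left
      (IntervalIntegrable.mono_Icc hT hv (left_mem_Icc.2 hT) hy)
      (IntervalIntegrable.mono_Icc hT hv (left_mem_Icc.2 hT) hx)]
  exact intervalIntegral.norm_integral_le_integral_norm hxy

theorem exists_bound_of_continuousOn {v : ℝ → E} {T : ℝ} (hv : ContinuousOn v (Icc 0 T)) :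
    ∃ C, 0 ≤ C ∧ ∀ t ∈ Icc 0 T, ‖v t‖ ≤ C := by
  obtain ⟨C, hC⟩ := isCompact_Icc.exists_bound_of_continuousOn hv
  exact ⟨max C 0, le_max_right _ _, fun t ht => (hC t ht).trans (le_max_left _ _)⟩

theorem bilin_dist_le (L : E →L[ℝ] F →L[ℝ] G) {C : ℝ} {x y : E} {z w : F}
    (hy : ‖y‖ ≤ C) (hz : ‖z‖ ≤ C) :
    dist (L x z) (L y w) ≤ ‖L‖ * C * (dist x y + dist z w) := by
  have h : L x z - L y w = L (x - y) z + L y (z - w) := by simp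
  rw [dist_eq_norm, h, dist_eq_norm, dist_eq_norm, mul_add]
  refine (norm_add_le _ _).trans (add_le_add ?_ ?_)
  · calc _ ≤ ‖L‖ * ‖x - y‖ * ‖z‖ := L.le_opNorm₂ _ _
      _ ≤ ‖L‖ * ‖x - y‖ * C := by gcongr
      _ = _ := by ring
  · calc _ ≤ ‖L‖ * ‖y‖ * ‖z - w‖ := L.le_opNorm₂ _ _
      _ ≤ ‖L‖ * C * ‖z - w‖ := by gcongr

theorem IntervalIntegrable.bilin_continuousOn (L : E →L[ℝ] F →L[ℝ] G) {f : ℝ → E} {g : ℝ → F}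
    {T : ℝ} (hT : 0 ≤ T) (hf : IntervalIntegrable f volume 0 T) (hg : ContinuousOn g (Icc 0 T)) :
    IntervalIntegrable (fun t => L (f t) (g t)) volume 0 T := by
  obtain ⟨C, hC0, hC⟩ := exists_bound_of_continuousOn hg
  rw [intervalIntegrable_iff_integrableOn_Icc_of_le hT] at hf ⊢
  refine Integrable.mono' (hf.norm.const_mul (‖L‖ * C)) ?_ ?_
  · exact L.aestronglyMeasurable_comp₂ hf.aestronglyMeasurable
      (hg.aestronglyMeasurable measurableSet_Icc)
  · filter_upwards [ae_restrict_mem measurableSet_Icc] with t ht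
    calc _ ≤ ‖L‖ * ‖f t‖ * ‖g t‖ := L.le_opNorm₂ _ _
      _ ≤ ‖L‖ * ‖f t‖ * C := by gcongr; exact hC t ht
      _ = _ := by ring

/-- Integration by parts for a bilinear map and two indefinite integrals. -/
theorem integral_bilin_primitive [CompleteSpace E] [CompleteSpace F] [CompleteSpace G]
    (L : E →L[ℝ] F →L[ℝ] G) {f : ℝ → E} {g : ℝ → F}
    {T : ℝ} (hT : 0 ≤ T) (hf : IntervalIntegrable f volume 0 T)
    (hg : IntervalIntegrable g volume 0 T) (c : E) (d : F) :
    (∫ t in (0 : ℝ)..T, L (f t) (d + ∫ s in (0 : ℝ)..t, g s)) +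
      ∫ t in (0 : ℝ)..T, L (c + ∫ s in (0 : ℝ)..t, f s) (g t) =
    L (c + ∫ s in (0 : ℝ)..T, f s) (d + ∫ s in (0 : ℝ)..T, g s) - L c d := by
  have hfc := continuousOn_primitive_Icc hT hf c
  have hgc := continuousOn_primitive_Icc hT hg d
  obtain ⟨C₁, hC₁0, hC₁⟩ := exists_bound_of_continuousOn hfc
  obtain ⟨C₂, hC₂0, hC₂⟩ := exists_bound_of_continuousOn hgc
  have i1 := IntervalIntegrable.bilin_continuousOn L hT hf hgc
  have i2 := IntervalIntegrable.bilin_continuousOn L.flip hT hg hfc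
  have := integral_eq_sub_of_dist_le (w := fun t => L (c + ∫ s in (0 : ℝ)..t, f s)
    (d + ∫ s in (0 : ℝ)..t, g s)) (a := 0) (b := T) hT
    (h := fun t => ‖L‖ * max C₁ C₂ * (‖f t‖ + ‖g t‖)) ((hf.norm.add hg.norm).const_mul _)
    (fun x hx y hy hxy => by
      refine (bilin_dist_le L ((hC₁ y hy).trans (le_max_left _ _))
        ((hC₂ x hx).trans (le_max_right _ _))).trans ?_
      rw [intervalIntegral.integral_const_mul, intervalIntegral.integral_add
        (IntervalIntegrable.mono_Icc hT hf hx hy).norm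
        (IntervalIntegrable.mono_Icc hT hg hx hy).norm]
      gcongr
      · exact dist_primitive_le hT hf c hx hy hxy
      · exact dist_primitive_le hT hg d hx hy hxy)
    (i1.add i2) (by
      filter_upwards [hf.ae_hasDerivAt_integral, hg.ae_hasDerivAt_integral] with t h1 h2 ht
      have := L.hasFDerivAt_of_bilinear ((h1 ht 0 left_mem_uIcc).const_add c).hasFDerivAt
        ((h2 ht 0 left_mem_uIcc).const_add d).hasFDerivAt
      have := this.hasDerivAt
      simpa [add_comm] using this)
  rw [intervalIntegral.integral_add i1 i2] at this
  simpa using this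

/-- A function which is non-negative to the right of a zero has non-negative derivative there. -/
theorem HasDerivAt.nonneg_of_right_nonneg {k : ℝ → ℝ} {k' t : ℝ} (hk : HasDerivAt k k' t)
    (h0 : k t = 0) (hpos : ∀ᶠ s in 𝓝[>] t, 0 ≤ k s) : 0 ≤ k' := by
  have h := (hasDerivAt_iff_tendsto_slope.1 hk).mono_left
    (nhdsWithin_mono t (fun s (hs : s ∈ Ioi t) => ne_of_gt hs))
  refine ge_of_tendsto h ?_
  filter_upwards [hpos, self_mem_nhdsWithin] with s hs hts
  rw [slope_def_field, h0, sub_zero]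
  exact div_nonneg hs (sub_nonneg.2 (le_of_lt hts))

end AbsolutelyContinuous

/-! ### Stability of integrably bounded increments. -/

section Energy

open Filter Topology

variable {E F G : Type*} [NormedAddCommGroup E] [NormedSpace ℝ E]
  [NormedAddCommGroup F] [NormedSpace ℝ F] [NormedAddCommGroup G] [NormedSpace ℝ G]

/-- The increments of `w` on `[0,T]` are bounded by those of an indefinite integral. -/
def HasIntegrableIncrements {E : Type*} [NormedAddCommGroup E] (T : ℝ) (w : ℝ → E) : Prop :=
  ∃ h : ℝ → ℝ, IntervalIntegrable h volume 0 T ∧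
    ∀ x ∈ Icc 0 T, ∀ y ∈ Icc 0 T, x ≤ y → dist (w x) (w y) ≤ ∫ t in x..y, h t

theorem HasIntegrableIncrements.absolutelyContinuous {T : ℝ} (hT : 0 ≤ T) {w : ℝ → E}
    (hw : HasIntegrableIncrements T w) : AbsolutelyContinuousOnInterval w 0 T := by
  obtain ⟨h, hh, hw⟩ := hw
  exact absolutelyContinuousOnInterval_of_dist_le hT hh hw

/-- Both factors are bounded on `[0,T]`, so a multiple of the sum of their majorants serves for the
product. Operator-valued factors are allowed, which makes `t ↦ ⟪B t (w t), w t⟫` absolutely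
continuous without differentiating `B`. -/
theorem HasIntegrableIncrements.bilin (L : E →L[ℝ] F →L[ℝ] G) {T : ℝ} (hT : 0 ≤ T) {f : ℝ → E}
    {g : ℝ → F} (hf : HasIntegrableIncrements T f) (hg : HasIntegrableIncrements T g) :
    HasIntegrableIncrements T fun t => L (f t) (g t) := by
  obtain ⟨C₁, hC₁⟩ := (hf.absolutelyContinuous hT).exists_bound
  obtain ⟨C₂, hC₂⟩ := (hg.absolutelyContinuous hT).exists_bound
  rw [uIcc_of_le hT] at hC₁ hC₂
  obtain ⟨h, hh, hf⟩ := hf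
  obtain ⟨k, hk, hg⟩ := hg
  have hC0 : 0 ≤ max C₁ C₂ :=
    (norm_nonneg _).trans ((hC₁ 0 (left_mem_Icc.2 hT)).trans (le_max_left _ _))
  refine ⟨fun t => ‖L‖ * max C₁ C₂ * (h t + k t), (hh.add hk).const_mul _,
    fun x hx y hy hxy => ?_⟩
  refine (bilin_dist_le L ((hC₁ y hy).trans (le_max_left _ _))
    ((hC₂ x hx).trans (le_max_right _ _))).trans ?_
  rw [intervalIntegral.integral_const_mul, intervalIntegral.integral_add
    (IntervalIntegrable.mono_Icc hT hh hx hy) (IntervalIntegrable.mono_Icc hT hk hx hy)]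
  gcongr
  · exact hf x hx y hy hxy
  · exact hg x hx y hy hxy

theorem HasIntegrableIncrements.of_lipschitz {T K : ℝ} {w : ℝ → E}
    (hw : ∀ x ∈ Icc 0 T, ∀ y ∈ Icc 0 T, ‖w x - w y‖ ≤ K * |x - y|) :
    HasIntegrableIncrements T w := by
  refine ⟨fun _ => K, intervalIntegrable_const, fun x hx y hy hxy => ?_⟩
  rw [dist_eq_norm, intervalIntegral.integral_const, smul_eq_mul, mul_comm]
  refine (hw x hx y hy).trans_eq ?_
  rw [abs_sub_comm, abs_of_nonneg (sub_nonneg.2 hxy)]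

theorem HasIntegrableIncrements.primitive {T : ℝ} (hT : 0 ≤ T) {v : ℝ → E}
    (hv : IntervalIntegrable v volume 0 T) (c : E) :
    HasIntegrableIncrements T fun t => c + ∫ s in (0 : ℝ)..t, v s :=
  ⟨_, hv.norm, fun _ hx _ hy hxy => dist_primitive_le hT hv c hx hy hxy⟩

theorem HasIntegrableIncrements.of_hasDerivAt {T : ℝ} {θ θ' : ℝ → ℝ}
    (hθ : ∀ t, HasDerivAt θ (θ' t) t) (hθ' : Continuous θ') : HasIntegrableIncrements T θ := by
  obtain ⟨C, -, hC⟩ := exists_bound_of_continuousOn (T := T) hθ'.continuousOn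
  refine HasIntegrableIncrements.of_lipschitz (K := C) fun x hx y hy => ?_
  exact (convex_Icc (0 : ℝ) T).norm_image_sub_le_of_norm_hasDerivWithin_le
    (fun t _ => (hθ t).hasDerivWithinAt) hC hy hx

end Energy

/-! ### The energy inequality for Lipschitz operator families. -/

section EnergyInequality

open Filter Topology

variable {E : Type*} [NormedAddCommGroup E] [InnerProductSpace ℝ E] [CompleteSpace E]

local notation "⟪" x ", " y "⟫" => inner ℝ x y

theorem continuous_of_opNorm_lipschitz {B : ℝ → E →L[ℝ] E} {K : ℝ}
    (hB : ∀ s t, ‖B s - B t‖ ≤ K * |s - t|) : Continuous B := by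
  refine (LipschitzWith.of_dist_le_mul (K := K.toNNReal) fun s t => ?_).continuous
  rw [dist_eq_norm, Real.dist_eq]
  exact (hB s t).trans (by gcongr; exact Real.le_coe_toNNReal K)

theorem intervalIntegrable_energy {B : ℝ → E →L[ℝ] E} {K : ℝ} (hBc : Continuous B)
    {θ θ' : ℝ → ℝ} (hθc : Continuous θ) (hθ' : Continuous θ')
    {T : ℝ} (hT : 0 ≤ T) {v : ℝ → E} (hv : IntervalIntegrable v volume 0 T) {w : ℝ → E}
    (hwc : ContinuousOn w (Icc 0 T)) :
    IntervalIntegrable (fun t => θ' t * ⟪B t (w t), w t⟫ + 2 * (θ t * ⟪B t (w t), v t⟫) +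
        K * (θ t * ‖w t‖ ^ 2)) volume 0 T := by
  have hBw : ContinuousOn (fun t => B t (w t)) (Icc 0 T) := hBc.continuousOn.clm_apply hwc
  refine ((ContinuousOn.intervalIntegrable ?_).add (IntervalIntegrable.const_mul ?_ 2)).add
    (ContinuousOn.intervalIntegrable ?_)
  · rw [uIcc_of_le hT]
    exact hθ'.continuousOn.mul (hBw.inner hwc)
  · refine IntervalIntegrable.continuousOn_mul ?_ hθc.continuousOn
    have := IntervalIntegrable.bilin_continuousOn (innerSL ℝ) hT hv hBw
    refine this.congr_ae (Eventually.of_forall fun t => ?_)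
    exact real_inner_comm _ _
  · rw [uIcc_of_le hT]
    exact continuousOn_const.mul (hθc.continuousOn.mul (hwc.norm.pow 2))

/-- The energy is absolutely continuous, so it is the integral of its a.e. derivative, although `B`
itself need not be differentiable. At a point `t` where the energy and `w` are differentiable,
freeze the operator at `B t` and add the Lipschitz error: the resulting majorant touches the energy
at `t` and lies above it to the right, so its derivative is at least that of the energy. -/
theorem energy_le_primitive {B : ℝ → E →L[ℝ] E} {K : ℝ} (hB : ∀ s t, ‖B s - B t‖ ≤ K * |s - t|)
    (hsymm : ∀ t x y, ⟪B t x, y⟫ = ⟪x, B t y⟫) {θ θ' : ℝ → ℝ}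
    (hθ : ∀ t, HasDerivAt θ (θ' t) t) (hθ' : Continuous θ') (hθ0 : ∀ t, 0 ≤ θ t)
    {T : ℝ} (hT : 0 ≤ T) {v : ℝ → E} (hv : IntervalIntegrable v volume 0 T) (c : E) (w : ℝ → E)
    (hw : w = fun t => c + ∫ s in (0 : ℝ)..t, v s) :
    θ T * ⟪B T (w T), w T⟫ - θ 0 * ⟪B 0 (w 0), w 0⟫ ≤
      ∫ t in (0 : ℝ)..T, (θ' t * ⟪B t (w t), w t⟫ + 2 * (θ t * ⟪B t (w t), v t⟫) +
        K * (θ t * ‖w t‖ ^ 2)) := by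
  have hBc := continuous_of_opNorm_lipschitz hB
  have hθc : Continuous θ := continuous_iff_continuousAt.2 fun t => (hθ t).continuousAt
  have hwc : ContinuousOn w (Icc 0 T) := hw ▸ continuousOn_primitive_Icc hT hv c
  have hwI : HasIntegrableIncrements T w := hw ▸ HasIntegrableIncrements.primitive hT hv c
  have hFI : HasIntegrableIncrements T fun t => θ t * ⟪B t (w t), w t⟫ := by
    have h1 : HasIntegrableIncrements T B := HasIntegrableIncrements.of_lipschitz fun x _ y _ => hB x y
    have h2 := h1.bilin (ContinuousLinearMap.id ℝ (E →L[ℝ] E)) hT hwI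
    have h3 := h2.bilin (innerSL ℝ) hT hwI
    exact (HasIntegrableIncrements.of_hasDerivAt hθ hθ').bilin (ContinuousLinearMap.mul ℝ ℝ) hT h3
  have hac := hFI.absolutelyContinuous hT
  rw [← hac.integral_deriv_eq_sub]
  refine intervalIntegral.integral_mono_ae_restrict hT hac.intervalIntegrable_deriv ?_ ?_
  · exact intervalIntegrable_energy hBc hθc hθ' hT hv hwc
  · have hae : ∀ᵐ t, t ∈ uIcc 0 T → deriv (fun t => θ t * ⟪B t (w t), w t⟫) t ≤
      θ' t * ⟪B t (w t), w t⟫ + 2 * (θ t * ⟪B t (w t), v t⟫) + K * (θ t * ‖w t‖ ^ 2) := by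
      filter_upwards [hac.ae_differentiableAt, hv.ae_hasDerivAt_integral] with t h1 h2 ht
      have hwd : HasDerivAt w (v t) t := by
        rw [hw]; exact (h2 ht 0 left_mem_uIcc).const_add c
      have hF := (h1 ht).hasDerivAt
      have hG : HasDerivAt (fun s => θ s * ⟪B t (w s), w s⟫)
          (θ' t * ⟪B t (w t), w t⟫ + θ t * (⟪B t (w t), v t⟫ + ⟪B t (v t), w t⟫)) t :=
        (hθ t).mul ((((B t).hasFDerivAt.comp_hasDerivAt t hwd)).inner ℝ hwd)
      -- This term pays for replacing `B s` by `B t` when `s > t`. It vanishes at `s = t` and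
      -- contributes exactly `K θ ‖w‖²` to the derivative.
      have hR : HasDerivAt (fun s => K * (s - t) * (θ s * ‖w s‖ ^ 2))
          (K * 1 * (θ t * ‖w t‖ ^ 2) + K * (t - t) *
            (θ' t * ‖w t‖ ^ 2 + θ t * (2 * ⟪w t, v t⟫))) t :=
        ((((hasDerivAt_id t).sub_const t).const_mul K).mul ((hθ t).mul hwd.norm_sq))
      have hK := (hG.add hR).sub hF
      have := HasDerivAt.nonneg_of_right_nonneg hK (by simp) (by
        filter_upwards [self_mem_nhdsWithin] with s hs
        have hs' : 0 ≤ s - t := sub_nonneg.2 (le_of_lt hs)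
        have h5 : ⟪(B s - B t) (w s), w s⟫ ≤ K * (s - t) * ‖w s‖ ^ 2 := by
          refine (real_inner_le_norm _ _).trans ?_
          rw [pow_two, ← mul_assoc]
          gcongr
          refine ((B s - B t).le_opNorm _).trans ?_
          gcongr
          simpa [abs_of_nonneg hs'] using hB s t
        have h6 := mul_le_mul_of_nonneg_left h5 (hθ0 s)
        simp only [Pi.sub_apply, Pi.add_apply]
        rw [sub_apply, inner_sub_left] at h6
        linarith)
      rw [hsymm t (v t), real_inner_comm (B t (w t)) (v t)] at this
      rw [sub_self] at this
      linarith
    filter_upwards [ae_restrict_of_ae hae, ae_restrict_mem measurableSet_Icc] with t h1 ht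
    exact h1 (by rwa [uIcc_of_le hT])

/-- The energy inequality for a symmetric Lipschitz family of operators along an absolutely
continuous curve. -/
theorem energy_le {B : ℝ → E →L[ℝ] E} {K : ℝ} (hB : ∀ s t, ‖B s - B t‖ ≤ K * |s - t|)
    (hsymm : ∀ t x y, ⟪B t x, y⟫ = ⟪x, B t y⟫) {θ θ' : ℝ → ℝ}
    (hθ : ∀ t, HasDerivAt θ (θ' t) t) (hθ' : Continuous θ') (hθ0 : ∀ t, 0 ≤ θ t)
    {T : ℝ} (hT : 0 ≤ T) {v : ℝ → E} (hv : IntervalIntegrable v volume 0 T) (w : ℝ → E)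
    (hw : ∀ t ∈ Icc 0 T, w t = w 0 + ∫ s in (0 : ℝ)..t, v s) :
    θ T * ⟪B T (w T), w T⟫ - θ 0 * ⟪B 0 (w 0), w 0⟫ ≤
      ∫ t in (0 : ℝ)..T, (θ' t * ⟪B t (w t), w t⟫ + 2 * (θ t * ⟪B t (w t), v t⟫) +
        K * (θ t * ‖w t‖ ^ 2)) := by
  have h := energy_le_primitive hB hsymm hθ hθ' hθ0 hT hv (w 0) _ rfl
  simp only [← hw T (right_mem_Icc.2 hT), ← hw 0 (left_mem_Icc.2 hT)] at h
  refine h.trans_eq (intervalIntegral.integral_congr fun t ht => ?_)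
  rw [uIcc_of_le hT] at ht
  simp only [← hw t ht]

end EnergyInequality

/-! ### Weak derivatives and primitives on an interval. -/

section WeakDerivatives

open Filter Topology

variable {E : Type*} [NormedAddCommGroup E] [NormedSpace ℝ E]

theorem setIntegral_Ioo_eq_intervalIntegral {T : ℝ} (hT : 0 ≤ T) (g : ℝ → E) :
    ∫ t in Ioo 0 T, g t = ∫ t in (0 : ℝ)..T, g t := by
  rw [intervalIntegral.integral_of_le hT, integral_Ioc_eq_integral_Ioo]

theorem restrict_Ioo_eq_restrict_Icc (T : ℝ) :
    (volume.restrict (Ioo 0 T) : Measure ℝ) = volume.restrict (Icc 0 T) :=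
  Measure.restrict_congr_set Ioo_ae_eq_Icc

theorem intervalIntegrable_iff_integrable_restrict_Ioo {T : ℝ} (hT : 0 ≤ T) {g : ℝ → E} :
    IntervalIntegrable g volume 0 T ↔ Integrable g (volume.restrict (Ioo 0 T)) := by
  rw [restrict_Ioo_eq_restrict_Icc, intervalIntegrable_iff_integrableOn_Icc_of_le hT]; rfl

theorem eqOn_Icc_of_ae_eq_Ioo {T : ℝ} (hT : 0 < T) {g k : ℝ → E}
    (hg : ContinuousOn g (Icc 0 T)) (hk : ContinuousOn k (Icc 0 T))
    (h : g =ᵐ[volume.restrict (Ioo 0 T)] k) : EqOn g k (Icc 0 T) := by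
  rw [restrict_Ioo_eq_restrict_Icc] at h
  exact Measure.eqOn_Icc_of_ae_eq volume hT.ne h hg hk

theorem exists_Icc_of_tsupport_subset_Ioo {φ : ℝ → ℝ} {T : ℝ} (hT : 0 < T)
    (hc : HasCompactSupport φ) (hs : tsupport φ ⊆ Ioo 0 T) :
    ∃ a b, 0 < a ∧ a < T ∧ 0 < b ∧ b < T ∧ ∀ t, t ∉ Icc a b → φ t = 0 := by
  rcases (tsupport φ).eq_empty_or_nonempty with h | h
  · refine ⟨T / 2, T / 2, by linarith, by linarith, by linarith, by linarith, fun t _ => ?_⟩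
    exact image_eq_zero_of_notMem_tsupport (by simp [h])
  · have hK : IsCompact (tsupport φ) := hc
    refine ⟨sInf (tsupport φ), sSup (tsupport φ), (hs (hK.sInf_mem h)).1, (hs (hK.sInf_mem h)).2,
      (hs (hK.sSup_mem h)).1, (hs (hK.sSup_mem h)).2, fun t ht => ?_⟩
    refine image_eq_zero_of_notMem_tsupport fun h' => ht ⟨?_, ?_⟩
    · exact csInf_le hK.bddBelow h'
    · exact le_csSup hK.bddAbove h'

/-- A function which is a.e. equal to an indefinite integral has a weak derivative. -/
theorem isWeakDeriv_of_ae_eq_primitive [CompleteSpace E] {T : ℝ} (hT : 0 < T) {g g' : ℝ → E}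
    (hg' : IntervalIntegrable g' volume 0 T) (c : E)
    (h : ∀ᵐ t ∂volume.restrict (Ioo 0 T), g t = c + ∫ s in (0 : ℝ)..t, g' s) :
    IsWeakDeriv T g g' := by
  intro φ hφ hφc hφs
  obtain ⟨a, b, ha0, haT, hb0, hbT, hab⟩ := exists_Icc_of_tsupport_subset_Ioo hT hφc hφs
  have hφ0 : φ 0 = 0 := hab 0 fun h => absurd h.1 (not_le.2 ha0)
  have hφT : φ T = 0 := hab T fun h => absurd h.2 (not_le.2 hbT)
  have hd : Differentiable ℝ φ := hφ.differentiable (by simp)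
  have hc : Continuous (deriv φ) := hφ.continuous_deriv (by simp)
  have hprim : ∀ t, φ t = 0 + ∫ s in (0 : ℝ)..t, deriv φ s := fun t => by
    rw [intervalIntegral.integral_deriv_eq_sub (fun x _ => hd x) (hc.intervalIntegrable _ _), hφ0]
    ring
  have key := integral_bilin_primitive (ContinuousLinearMap.lsmul ℝ ℝ (E := E)) hT.le
    (hc.intervalIntegrable 0 T) hg' (0 : ℝ) c
  simp only [← hprim, hφT, ContinuousLinearMap.lsmul_apply, zero_smul, sub_zero] at key
  rw [← setIntegral_Ioo_eq_intervalIntegral hT.le, ← setIntegral_Ioo_eq_intervalIntegral hT.le]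
    at key
  rw [← eq_neg_of_add_eq_zero_left key]
  refine integral_congr_ae ?_
  filter_upwards [h] with t ht
  rw [ht]

/-- The primitive from `0` vanishes before the support of `ζ`, and the zero mean makes it vanish
again after it. -/
theorem exists_test_primitive {ζ : ℝ → ℝ} {T : ℝ} (hT : 0 < T) (hζ : ContDiff ℝ ∞ ζ)
    (hc : HasCompactSupport ζ) (hs : tsupport ζ ⊆ Ioo 0 T) (h0 : ∫ t in (0 : ℝ)..T, ζ t = 0) :
    ∃ φ : ℝ → ℝ, ContDiff ℝ ∞ φ ∧ HasCompactSupport φ ∧ tsupport φ ⊆ Ioo 0 T ∧ deriv φ = ζ := by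
  obtain ⟨a, b, ha0, haT, hb0, hbT, hab⟩ := exists_Icc_of_tsupport_subset_Ioo hT hc hs
  set φ : ℝ → ℝ := fun t => ∫ s in (0 : ℝ)..t, ζ s with hφ
  have hcont := hζ.continuous
  have hd : deriv φ = ζ := by
    ext t; exact hcont.deriv_integral ζ 0 t
  have hsupp : Function.support φ ⊆ Icc a b := by
    intro t ht
    by_contra h
    refine ht ?_
    rcases not_and_or.1 h with h | h
    · refine intervalIntegral.integral_zero_ae (Eventually.of_forall fun s hs => hab s fun hs' => ?_)
      have := hs'.1
      have := (uIoc_subset_uIcc hs).2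
      have : s ≤ max 0 t := this
      rcases le_max_iff.1 this with h1 | h1 <;> linarith
    · have h1 : φ T = φ t + ∫ s in t..T, ζ s :=
        (intervalIntegral.integral_add_adjacent_intervals (hcont.intervalIntegrable _ _)
          (hcont.intervalIntegrable _ _)).symm
      have h2 : ∫ s in t..T, ζ s = 0 := by
        refine intervalIntegral.integral_zero_ae
          (Eventually.of_forall fun s hs => hab s fun hs' => ?_)
        have := hs'.2
        have h3 : min t T ≤ s := (uIoc_subset_uIcc hs).1
        rcases min_le_iff.1 h3 with h1 | h1 <;> linarith
      rw [h2, add_zero] at h1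
      rw [← h1]; exact h0
  have htsupp : tsupport φ ⊆ Icc a b := closure_minimal hsupp isClosed_Icc
  refine ⟨φ, ?_, ?_, ?_, hd⟩
  · rw [contDiff_infty_iff_deriv, hd]
    exact ⟨fun t => (hcont.integral_hasStrictDerivAt 0 t).hasDerivAt.differentiableAt, hζ⟩
  · exact isCompact_Icc.of_isClosed_subset (isClosed_tsupport _) htsupp
  · exact htsupp.trans fun t ht => ⟨ha0.trans_le ht.1, ht.2.trans_lt hbT⟩

theorem integral_smul_eq_setIntegral {η : ℝ → ℝ} {T : ℝ} (hs : tsupport η ⊆ Ioo 0 T) (g : ℝ → E) :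
    ∫ t, η t • g t = ∫ t in Ioo 0 T, η t • g t := by
  refine (setIntegral_eq_integral_of_forall_compl_eq_zero fun t ht => ?_).symm
  rw [image_eq_zero_of_notMem_tsupport fun h => ht (hs h), zero_smul]

theorem integrable_continuous_smul {η : ℝ → ℝ} (hη : Continuous η) {T : ℝ} (hT : 0 ≤ T) {g : ℝ → E}
    (hg : IntervalIntegrable g volume 0 T) :
    Integrable (fun t => η t • g t) (volume.restrict (Ioo 0 T)) := by
  rw [← intervalIntegrable_iff_integrable_restrict_Ioo hT]
  exact hg.continuousOn_smul hη.continuousOn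

/-- The fundamental lemma of the calculus of variations on `(0,T)`. -/
theorem ae_eq_zero_of_integral_test [CompleteSpace E] {T : ℝ} (hT : 0 ≤ T) {g : ℝ → E}
    (hg : IntervalIntegrable g volume 0 T)
    (h : ∀ η : ℝ → ℝ, ContDiff ℝ ∞ η → HasCompactSupport η → tsupport η ⊆ Ioo 0 T →
      ∫ t in Ioo 0 T, η t • g t = 0) :
    ∀ᵐ t ∂volume.restrict (Ioo 0 T), g t = 0 := by
  rw [ae_restrict_iff' measurableSet_Ioo]
  refine isOpen_Ioo.ae_eq_zero_of_integral_contDiff_smul_eq_zero ?_ fun η h1 h2 h3 => ?_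
  · rw [intervalIntegrable_iff_integrable_restrict_Ioo hT] at hg
    exact IntegrableOn.locallyIntegrableOn hg
  · rw [integral_smul_eq_setIntegral h3]
    exact h η h1 h2 h3

/-- A function with an integrable weak derivative is a.e. equal to an indefinite integral. -/
theorem IsWeakDeriv.ae_eq_primitive [CompleteSpace E] {T : ℝ} (hT : 0 < T) {g g' : ℝ → E}
    (hg : IntervalIntegrable g volume 0 T) (hg' : IntervalIntegrable g' volume 0 T)
    (h : IsWeakDeriv T g g') :
    ∃ c, ∀ᵐ t ∂volume.restrict (Ioo 0 T), g t = c + ∫ s in (0 : ℝ)..t, g' s := by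
  set G : ℝ → E := fun t => 0 + ∫ s in (0 : ℝ)..t, g' s with hG
  have hGw : IsWeakDeriv T G g' := isWeakDeriv_of_ae_eq_primitive hT hg' 0 (ae_of_all _ fun _ => rfl)
  have hGc : ContinuousOn G (Icc 0 T) := continuousOn_primitive_Icc hT.le hg' 0
  have hGi : IntervalIntegrable G volume 0 T :=
    ContinuousOn.intervalIntegrable (by rwa [uIcc_of_le hT.le])
  have hk : IntervalIntegrable (fun t => g t - G t) volume 0 T := hg.sub hGi
  have hk0 : ∀ φ : ℝ → ℝ, ContDiff ℝ ∞ φ → HasCompactSupport φ → tsupport φ ⊆ Ioo 0 T →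
      ∫ t in Ioo 0 T, deriv φ t • (g t - G t) = 0 := by
    intro φ h1 h2 h3
    have hc : Continuous (deriv φ) := h1.continuous_deriv (by simp)
    simp only [smul_sub]
    rw [integral_sub (integrable_continuous_smul hc hT.le hg)
      (integrable_continuous_smul hc hT.le hGi), h φ h1 h2 h3, hGw φ h1 h2 h3, sub_self]
  -- A bump of mass one supported in `[T/4, 3T/4]`. Subtracting a multiple of it gives any test
  -- function zero mean, hence makes it the derivative of a test function.
  let f : ContDiffBump (T / 2) := ⟨T / 8, T / 4, by linarith, by linarith⟩
  set φ₀ : ℝ → ℝ := f.normed volume with hφ₀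
  have hφ₀s : tsupport φ₀ ⊆ Ioo 0 T := by
    rw [hφ₀, f.tsupport_normed_eq, Real.closedBall_eq_Icc]
    exact fun t ht => ⟨by have := ht.1; simp only [f] at this; linarith,
      by have := ht.2; simp only [f] at this; linarith⟩
  have hφ₀d : ContDiff ℝ ∞ φ₀ := f.contDiff_normed
  have hφ₀i : ∫ t in (0 : ℝ)..T, φ₀ t = 1 := by
    rw [← setIntegral_Ioo_eq_intervalIntegral hT.le]
    have := integral_smul_eq_setIntegral (E := ℝ) hφ₀s fun _ => 1
    simp only [smul_eq_mul, mul_one] at this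
    rw [← this]
    exact f.integral_normed
  refine ⟨∫ t in Ioo 0 T, φ₀ t • (g t - G t), ?_⟩
  set c := ∫ t in Ioo 0 T, φ₀ t • (g t - G t) with hc
  have key : ∀ᵐ t ∂volume.restrict (Ioo 0 T), g t - G t - c = 0 := by
    refine ae_eq_zero_of_integral_test hT.le (hk.sub intervalIntegrable_const) fun η h1 h2 h3 => ?_
    set m := ∫ t in (0 : ℝ)..T, η t with hm
    obtain ⟨φ, hφ1, hφ2, hφ3, hφ4⟩ := exists_test_primitive (ζ := fun t => η t - m * φ₀ t) hT
      (h1.sub (contDiff_const.mul hφ₀d)) (h2.sub (f.hasCompactSupport_normed.mul_left))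
      ((tsupport_sub _ _).trans (union_subset h3
        ((tsupport_mul_subset_right).trans hφ₀s))) (by
        rw [intervalIntegral.integral_sub (h1.continuous.intervalIntegrable _ _)
          ((hφ₀d.continuous.const_mul m).intervalIntegrable _ _),
          intervalIntegral.integral_const_mul, hφ₀i]
        ring)
    have h5 := hk0 φ hφ1 hφ2 hφ3
    rw [hφ4] at h5
    simp only [sub_smul, mul_smul] at h5
    rw [integral_sub (integrable_continuous_smul h1.continuous hT.le hk)
      ((integrable_continuous_smul hφ₀d.continuous hT.le hk).fun_smul m), integral_smul, ← hc] at h5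
    simp only [smul_sub _ _ c]
    rw [integral_sub (integrable_continuous_smul h1.continuous hT.le hk)
      (integrable_continuous_smul h1.continuous hT.le intervalIntegrable_const),
      integral_smul_const, setIntegral_Ioo_eq_intervalIntegral hT.le η]
    exact h5
  filter_upwards [key] with t ht
  rw [sub_sub, sub_eq_zero] at ht
  rw [ht, hG]; simp only [zero_add]; abel

/-- A function with an integrable weak derivative and a prescribed initial value. -/
theorem IsWeakDeriv.ae_eq_primitive_of_initialValue [CompleteSpace E] {T : ℝ} (hT : 0 < T)
    {g g' : ℝ → E} (hg : IntervalIntegrable g volume 0 T) (hg' : IntervalIntegrable g' volume 0 T)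
    (h : IsWeakDeriv T g g') {x : E} (hx : HasInitialValue T g x) :
    ∀ᵐ t ∂volume.restrict (Ioo 0 T), g t = x + ∫ s in (0 : ℝ)..t, g' s := by
  obtain ⟨c, hc⟩ := h.ae_eq_primitive hT hg hg'
  obtain ⟨U, ⟨hU, hUg⟩, hU0⟩ := hx
  have := eqOn_Icc_of_ae_eq_Ioo hT hU (continuousOn_primitive_Icc hT.le hg' c) (hUg.trans hc)
    (left_mem_Icc.2 hT.le)
  simp only [hU0, intervalIntegral.integral_same, add_zero] at this
  rwa [this]

theorem hasInitialValue_of_ae_eq_primitive {T : ℝ} (hT : 0 < T)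
    {g g' : ℝ → E} (hg' : IntervalIntegrable g' volume 0 T) {x : E}
    (h : ∀ᵐ t ∂volume.restrict (Ioo 0 T), g t = x + ∫ s in (0 : ℝ)..t, g' s) :
    HasInitialValue T g x :=
  ⟨_, ⟨continuousOn_primitive_Icc hT.le hg' x, h.mono fun _ ht => ht.symm⟩, by simp⟩

end WeakDerivatives

/-! ### Lions' representation theorem. -/

section Lions

variable {X W : Type*} [NormedAddCommGroup X] [InnerProductSpace ℝ X] [CompleteSpace X]
  [AddCommGroup W] [Module ℝ W]

/-- Riesz representation of a functional which is controlled by a linear map. -/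
theorem exists_inner_eq_of_abs_le (P : W →ₗ[ℝ] X) (l : W →ₗ[ℝ] ℝ) (C : ℝ)
    (h : ∀ w, |l w| ≤ C * ‖P w‖) : ∃ u : X, ∀ w, inner ℝ (P w) u = l w := by
  have hker : LinearMap.ker P ≤ LinearMap.ker l := fun w hw => by
    have := h w
    rw [LinearMap.mem_ker.1 hw, norm_zero, mul_zero] at this
    exact LinearMap.mem_ker.2 (abs_nonpos_iff.1 this)
  let m : LinearMap.range P →ₗ[ℝ] ℝ :=
    ((LinearMap.ker P).liftQ l hker).comp P.quotKerEquivRange.symm.toLinearMap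
  have hm : ∀ w, m ⟨P w, LinearMap.mem_range_self P w⟩ = l w := fun w => by
    have : P.quotKerEquivRange.symm ⟨P w, LinearMap.mem_range_self P w⟩ =
        (LinearMap.ker P).mkQ w := P.quotKerEquivRange_symm_apply_image w _
    simp [m, this]
  let M : StrongDual ℝ (LinearMap.range P) := m.mkContinuous C (by
    rintro ⟨_, w, rfl⟩
    exact (congrArg abs (hm w)).le.trans (h w))
  -- Hahn–Banach is needed because the range of `P` need not be all of `X`, nor closed.
  obtain ⟨g, hg, -⟩ := exists_extension_norm_eq (LinearMap.range P) M
  refine ⟨(InnerProductSpace.toDual ℝ X).symm g, fun w => ?_⟩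
  rw [real_inner_comm, InnerProductSpace.toDual_symm_apply]
  exact (hg ⟨P w, LinearMap.mem_range_self P w⟩).trans (hm w)

/-- Lions' representation theorem. -/
theorem exists_mem_closure_range_inner_eq (ι Φ : W →ₗ[ℝ] X) (l : W →ₗ[ℝ] ℝ) (N : W → ℝ)
    {c C : ℝ} (hc : 0 < c) (hC : 0 ≤ C) (hN : ∀ w, ‖ι w‖ ≤ N w) (hl : ∀ w, |l w| ≤ C * N w)
    (hΦ : ∀ w, c * N w ^ 2 ≤ inner ℝ (Φ w) (ι w)) :
    ∃ u ∈ (LinearMap.range ι).topologicalClosure, ∀ w, inner ℝ (Φ w) u = l w := by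
  set S := (LinearMap.range ι).topologicalClosure with hS
  have : CompleteSpace S := (LinearMap.range ι).isClosed_topologicalClosure.completeSpace_coe
  -- Projecting `Φ` onto the closure of the range of `ι` leaves its pairing with `ι` unchanged, and
  -- forces the representing vector into that closure.
  let P : W →ₗ[ℝ] S := (S.orthogonalProjectionOnto : X →L[ℝ] S).toLinearMap.comp Φ
  have hι : ∀ w, ι w ∈ S := fun w =>
    (LinearMap.range ι).le_topologicalClosure (LinearMap.mem_range_self ι w)
  have hP : ∀ w (s : S), inner ℝ (P w) s = inner ℝ (Φ w) (s : X) := fun w s =>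
    Submodule.inner_orthogonalProjectionOnto_eq_of_mem_right s (Φ w)
  obtain ⟨u, hu⟩ := exists_inner_eq_of_abs_le P l (C / c) fun w => by
    have h1 : c * N w ^ 2 ≤ ‖P w‖ * N w :=
      calc c * N w ^ 2 ≤ inner ℝ (Φ w) (ι w) := hΦ w
        _ = inner ℝ (P w) (⟨ι w, hι w⟩ : S) := (hP w ⟨ι w, hι w⟩).symm
        _ ≤ ‖P w‖ * ‖(⟨ι w, hι w⟩ : S)‖ := real_inner_le_norm _ _
        _ ≤ ‖P w‖ * N w := by gcongr; exact hN w
    have h2 : c * N w ≤ ‖P w‖ := by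
      rcases ((norm_nonneg _).trans (hN w)).eq_or_lt with h | h
      · rw [← h]; simp
      · nlinarith
    refine (hl w).trans ?_
    rw [div_mul_eq_mul_div, le_div_iff₀ hc, mul_assoc, mul_comm (N w)]
    gcongr
  exact ⟨u, u.2, fun w => (hP w u).symm.trans (hu w)⟩

/-- Carries linear relations between smooth functions, their derivatives and their traces over to
the vector supplied by Lions' theorem. -/
theorem inner_eq_zero_of_mem_closure_range (ι : W →ₗ[ℝ] X) {u ξ : X}
    (hu : u ∈ (LinearMap.range ι).topologicalClosure) (h : ∀ w, inner ℝ ξ (ι w) = 0) :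
    inner ℝ ξ u = 0 := by
  have hcl : IsClosed {x : X | inner ℝ ξ x = 0} :=
    isClosed_eq (continuous_const.inner continuous_id) continuous_const
  refine closure_minimal ?_ hcl hu
  rintro _ ⟨w, rfl⟩
  exact h w

end Lions

/-! ### Mild solutions and uniqueness. -/

section Mild

open Filter Topology

variable {V H : Type*} [NormedAddCommGroup V] [InnerProductSpace ℝ V] [CompleteSpace V]
  [NormedAddCommGroup H] [InnerProductSpace ℝ H] [CompleteSpace H]

local notation "⟪" x ", " y "⟫" => inner ℝ x y

/-- A symmetric, Lipschitz and quasi-coercive family of operators on `V`. -/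
structure IsWaveFamily (j : V →L[ℝ] H) (A : ℝ → V →L[ℝ] V) (K α κ : ℝ) : Prop where
  lip : ∀ s t, ‖A s - A t‖ ≤ K * |s - t|
  symm : ∀ t x y, ⟪A t x, y⟫ = ⟪x, A t y⟫
  pos : 0 < α
  coercive : ∀ t x, α * ‖x‖ ^ 2 ≤ ⟪A t x, x⟫ + κ * ‖j x‖ ^ 2

/-- The wave equation, integrated in time, on `(0,T)`; `V'` is identified with `V`. -/
structure IsMildSolution (j : V →L[ℝ] H) (A : ℝ → V →L[ℝ] V) (T : ℝ) (u₀ : V) (u₁ : H)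
    (f : ℝ → H) (u : ℝ → V) (p : ℝ → H) : Prop where
  memLp_fst : MemLp u 2 (volume.restrict (Ioo 0 T))
  memLp_snd : MemLp p 2 (volume.restrict (Ioo 0 T))
  first : ∀ᵐ t ∂volume.restrict (Ioo 0 T), j (u t) = j u₀ + ∫ s in (0 : ℝ)..t, p s
  second : ∀ᵐ t ∂volume.restrict (Ioo 0 T), j.adjoint (p t) =
    j.adjoint u₁ + ∫ s in (0 : ℝ)..t, (j.adjoint (f s) - A s (u s))

theorem MemLp.intervalIntegrable_Ioo {E : Type*} [NormedAddCommGroup E] [NormedSpace ℝ E] {T : ℝ}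
    (hT : 0 ≤ T) {g : ℝ → E} (hg : MemLp g 2 (volume.restrict (Ioo 0 T))) :
    IntervalIntegrable g volume 0 T :=
  (intervalIntegrable_iff_integrable_restrict_Ioo hT).2 (hg.integrable one_le_two)

namespace IsWaveFamily

variable {j : V →L[ℝ] H} {A : ℝ → V →L[ℝ] V} {K α κ : ℝ}

theorem continuous (hA : IsWaveFamily j A K α κ) : Continuous A :=
  continuous_of_opNorm_lipschitz hA.lip

/-- The coercive family `A + κ j^* j`. -/
theorem shift (hA : IsWaveFamily j A K α κ) :
    IsWaveFamily j (fun t => A t + κ • (j.adjoint ∘L j)) K α 0 where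
  lip s t := by simpa using hA.lip s t
  symm t x y := by
    simp [inner_add_left, inner_add_right, inner_smul_left, inner_smul_right, hA.symm,
      ContinuousLinearMap.adjoint_inner_left, ContinuousLinearMap.adjoint_inner_right]
  pos := hA.pos
  coercive t x := by
    have := hA.coercive t x
    simpa [inner_add_left, inner_smul_left, ContinuousLinearMap.adjoint_inner_left] using this

theorem intervalIntegrable_apply (hA : IsWaveFamily j A K α κ) {T : ℝ} (hT : 0 ≤ T) {u : ℝ → V}
    (hu : IntervalIntegrable u volume 0 T) : IntervalIntegrable (fun t => A t (u t)) volume 0 T :=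
  IntervalIntegrable.bilin_continuousOn (ContinuousLinearMap.id ℝ (V →L[ℝ] V)).flip hT hu
    hA.continuous.continuousOn

/-- A weight which dominates the lower order terms in the energy estimates. -/
theorem exists_weight (hA : IsWaveFamily j A K α κ) :
    ∃ lam : ℝ, |κ| + 1 ≤ lam ∧ K + |κ| * ‖j‖ ^ 2 + 1 ≤ lam * α := by
  refine ⟨|κ| + 1 + (|K| + |κ| * ‖j‖ ^ 2 + 1) / α, ?_, ?_⟩
  · have : 0 ≤ (|K| + |κ| * ‖j‖ ^ 2 + 1) / α := div_nonneg (by positivity) hA.pos.le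
    linarith
  · rw [add_mul, div_mul_cancel₀ _ hA.pos.ne']
    have : 0 ≤ (|κ| + 1) * α := mul_nonneg (by positivity) hA.pos.le
    linarith [le_abs_self K]

end IsWaveFamily

theorem hasDerivAt_exp_const_mul (r t : ℝ) :
    HasDerivAt (fun t => Real.exp (r * t)) (r * Real.exp (r * t)) t := by
  simpa [mul_comm] using ((hasDerivAt_id t).const_mul r).exp

/-- Young's inequality with reciprocal weights. In the uniqueness proof `j u` and `j w` carry the
weights `exp (-lam t)` and `exp (lam t)`, and the cross term must be split accordingly. -/
theorem two_mul_inner_le_weighted {κ e e' : ℝ} (he : 0 ≤ e) (he' : 0 ≤ e') (hee : e * e' = 1)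
    (x y : H) : -(2 * κ * ⟪x, y⟫) ≤ |κ| * (e * ‖x‖ ^ 2 + e' * ‖y‖ ^ 2) := by
  have h1 : |⟪x, y⟫| ≤ ‖x‖ * ‖y‖ := abs_real_inner_le_norm x y
  have h2 : 2 * (‖x‖ * ‖y‖) ≤ e * ‖x‖ ^ 2 + e' * ‖y‖ ^ 2 := by
    have h3 : (2 * (‖x‖ * ‖y‖)) ^ 2 ≤ (e * ‖x‖ ^ 2 + e' * ‖y‖ ^ 2) ^ 2 := by
      have h4 : (2 * (‖x‖ * ‖y‖)) ^ 2 = 4 * (e * e') * (‖x‖ ^ 2 * ‖y‖ ^ 2) := by rw [hee]; ring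
      rw [h4]
      nlinarith [sq_nonneg (e * ‖x‖ ^ 2 - e' * ‖y‖ ^ 2)]
    exact (pow_le_pow_iff_left₀ (by positivity) (by positivity) two_ne_zero).1 h3
  calc -(2 * κ * ⟪x, y⟫) ≤ |2 * κ * ⟪x, y⟫| := neg_le_abs _
    _ = |κ| * (2 * |⟪x, y⟫|) := by rw [abs_mul, abs_mul, abs_two]; ring
    _ ≤ _ := by gcongr; linarith

/-- Uniqueness for the homogeneous problem. -/
theorem IsMildSolution.ae_eq_zero {j : V →L[ℝ] H} {A : ℝ → V →L[ℝ] V} {K α κ : ℝ}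
    (hA : IsWaveFamily j A K α κ) {T : ℝ} (hT : 0 ≤ T) {u : ℝ → V} {p : ℝ → H}
    (h : IsMildSolution j A T 0 0 0 u p) :
    ∀ᵐ t ∂volume.restrict (Ioo 0 T), j (u t) = 0 := by
  obtain ⟨lam, hl1, hl2⟩ := hA.exists_weight
  have hu := MemLp.intervalIntegrable_Ioo hT h.memLp_fst
  have hp := MemLp.intervalIntegrable_Ioo hT h.memLp_snd
  have hcm : ∀ r : ℝ, Continuous fun t => Real.exp (r * t) := fun r =>
    Real.continuous_exp.comp (continuous_const.mul continuous_id)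
  -- The multiplier `w` below is the antiderivative of `v` with `w T = 0`, so that `u = exp (lam t)
  -- w'`.
  set v : ℝ → V := fun t => Real.exp (-lam * t) • u t with hv
  have hvi : IntervalIntegrable v volume 0 T := hu.continuousOn_smul (hcm _).continuousOn
  have hAu := hA.intervalIntegrable_apply hT hu
  set w : ℝ → V := fun t => -(∫ s in (0 : ℝ)..T, v s) + ∫ s in (0 : ℝ)..t, v s with hw
  have hwT : w T = 0 := by simp [hw]
  have hwc : ContinuousOn w (Icc 0 T) := continuousOn_primitive_Icc hT hvi _
  set q : ℝ → H := fun t => 0 + ∫ s in (0 : ℝ)..t, p s with hq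
  have hqc : ContinuousOn q (Icc 0 T) := continuousOn_primitive_Icc hT hp _
  set B : ℝ → V →L[ℝ] V := fun t => A t + κ • (j.adjoint ∘L j) with hB
  have hBf : IsWaveFamily j B K α 0 := hA.shift
  set g : ℝ → V := fun t => -A t (u t) with hg
  have hgi : IntervalIntegrable g volume 0 T := hAu.neg
  set G : ℝ → V := fun t => 0 + ∫ s in (0 : ℝ)..t, g s with hG
  have hGc : ContinuousOn G (Icc 0 T) := continuousOn_primitive_Icc hT hgi _
  -- The homogeneous equation tested with `w`; the boundary terms vanish because `G 0 = 0` and `w T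
  -- = 0`.
  have e1 : (∫ t in (0 : ℝ)..T, ⟪g t, w t⟫) + ∫ t in (0 : ℝ)..T, ⟪G t, v t⟫ = 0 :=
    (integral_bilin_primitive (innerSL ℝ) hT hgi hvi (0 : V) (-(∫ s in (0 : ℝ)..T, v s))).trans
      (by simp)
  have e2 := energy_le (B := fun _ => ContinuousLinearMap.id ℝ H) (K := 0) (by simp) (by simp)
    (hasDerivAt_exp_const_mul (-lam)) (continuous_const.mul (hcm _))
    (fun t => (Real.exp_pos _).le) hT hp q (by simp [hq])
  -- The sign is reversed to use the one-sided inequality from below: as `w T = 0`, the remaining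
  -- boundary term is `⟪B 0 (w 0), w 0⟫ ≥ 0`.
  have e3 := energy_le (B := fun t => -B t) (K := K) (fun s t => by
      rw [neg_sub_neg, norm_sub_rev]; exact hBf.lip s t)
    (fun t x y => by simp [hBf.symm]) (hasDerivAt_exp_const_mul lam) (continuous_const.mul (hcm _))
    (fun t => (Real.exp_pos _).le) hT hvi w (by simp [hw])
  have i1 : IntervalIntegrable (fun t => ⟪g t, w t⟫) volume 0 T :=
    IntervalIntegrable.bilin_continuousOn (innerSL ℝ) hT hgi hwc
  have i1' : IntervalIntegrable (fun t => ⟪G t, v t⟫) volume 0 T :=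
    IntervalIntegrable.bilin_continuousOn (innerSL ℝ).flip hT hvi hGc
  have i2 := intervalIntegrable_energy (B := fun _ => ContinuousLinearMap.id ℝ H) (K := 0)
    continuous_const (hcm (-lam)) (continuous_const.mul (hcm (-lam)) : Continuous fun t =>
      -lam * Real.exp (-lam * t)) hT hp hqc
  have i3 := intervalIntegrable_energy (B := fun t => -B t) (K := K)
    hBf.continuous.neg (hcm lam) (continuous_const.mul (hcm lam) : Continuous fun t =>
      lam * Real.exp (lam * t)) hT hvi hwc
  set I₂ := fun t => -lam * Real.exp (-lam * t) * ⟪ContinuousLinearMap.id ℝ H (q t), q t⟫ +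
    2 * (Real.exp (-lam * t) * ⟪ContinuousLinearMap.id ℝ H (q t), p t⟫) +
    0 * (Real.exp (-lam * t) * ‖q t‖ ^ 2) with hI₂
  set I₃ := fun t => lam * Real.exp (lam * t) * ⟪(-B t) (w t), w t⟫ +
    2 * (Real.exp (lam * t) * ⟪(-B t) (w t), v t⟫) +
    K * (Real.exp (lam * t) * ‖w t‖ ^ 2) with hI₃
  change IntervalIntegrable I₂ volume 0 T at i2
  change IntervalIntegrable I₃ volume 0 T at i3
  have h2 : 0 ≤ ∫ t in (0 : ℝ)..T, I₂ t := by
    refine le_trans ?_ e2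
    have : q 0 = 0 := by simp [hq]
    simp only [this, inner_zero_right, mul_zero, sub_zero, ContinuousLinearMap.id_apply]
    exact mul_nonneg (Real.exp_pos _).le real_inner_self_nonneg
  have h3 : 0 ≤ ∫ t in (0 : ℝ)..T, I₃ t := by
    refine le_trans ?_ e3
    have := hBf.coercive 0 (w 0)
    simp only [hwT, inner_zero_right, mul_zero, zero_sub, neg_apply, inner_neg_left, mul_neg,
      neg_neg]
    refine mul_nonneg (Real.exp_pos _).le (le_trans ?_ (this.trans_eq (by simp)))
    exact mul_nonneg hA.pos.le (sq_nonneg _)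
  -- The energy inequalities give `∫ Z ≥ 0`, whereas the choice of `lam` gives `Z ≤ -exp (-lam t) ‖j
  -- u‖²` a.e.; hence `Z` and `j u` vanish a.e.
  set Z := fun t => I₂ t + I₃ t - 2 * (⟪g t, w t⟫ + ⟪G t, v t⟫) with hZ
  have iZ : IntervalIntegrable Z volume 0 T := (i2.add i3).sub ((i1.add i1').const_mul 2)
  have hZ0 : 0 ≤ ∫ t in (0 : ℝ)..T, Z t := by
    rw [intervalIntegral.integral_sub (i2.add i3) ((i1.add i1').const_mul 2),
      intervalIntegral.integral_add i2 i3, intervalIntegral.integral_const_mul,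
      intervalIntegral.integral_add i1 i1', e1]
    linarith
  have hZle : ∀ᵐ t ∂volume.restrict (Ioo 0 T), Real.exp (-lam * t) * ‖j (u t)‖ ^ 2 ≤ -Z t := by
    filter_upwards [h.first, h.second] with t h1 h2
    have hq' : q t = j (u t) := by rw [h1]; simp [hq]
    have hG' : G t = j.adjoint (p t) := by rw [h2]; simp [hG, hg]
    have hee : Real.exp (-lam * t) * Real.exp (lam * t) = 1 := by
      rw [← Real.exp_add]; simp
    have hee' : Real.exp (lam * t) * Real.exp (-lam * t) = 1 := by rw [mul_comm, hee]
    have hBu : ⟪B t (w t), u t⟫ = ⟪A t (u t), w t⟫ + κ * ⟪j (u t), j (w t)⟫ := by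
      rw [hBf.symm, real_inner_comm]
      simp [hB, inner_add_left, inner_smul_left, ContinuousLinearMap.adjoint_inner_left]
    have hGv : ⟪G t, v t⟫ = Real.exp (-lam * t) * ⟪j (u t), p t⟫ := by
      rw [hG', hv, inner_smul_right, ContinuousLinearMap.adjoint_inner_left, real_inner_comm]
    have hBv : Real.exp (lam * t) * ⟪B t (w t), v t⟫ = ⟪B t (w t), u t⟫ := by
      rw [hv, inner_smul_right, ← mul_assoc, hee', one_mul]
    have hco := hBf.coercive t (w t)
    have hcr := two_mul_inner_le_weighted (κ := κ) (Real.exp_pos (-lam * t)).le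
      (Real.exp_pos (lam * t)).le hee (j (u t)) (j (w t))
    have hjw : ‖j (w t)‖ ^ 2 ≤ ‖j‖ ^ 2 * ‖w t‖ ^ 2 := by
      rw [← mul_pow]; gcongr; exact j.le_opNorm _
    have hZt : Z t = -lam * (Real.exp (-lam * t) * ‖j (u t)‖ ^ 2) -
        lam * (Real.exp (lam * t) * ⟪B t (w t), w t⟫) + K * (Real.exp (lam * t) * ‖w t‖ ^ 2) -
        2 * κ * ⟪j (u t), j (w t)⟫ := by
      simp only [hZ, hI₂, hI₃, hq', hGv, neg_apply, inner_neg_left, hg,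
        ContinuousLinearMap.id_apply, real_inner_self_eq_norm_sq, mul_neg, hBv, hBu]
      ring
    have hlam : 0 ≤ lam := by linarith [abs_nonneg κ]
    have he1 := Real.exp_pos (lam * t)
    have he2 := Real.exp_pos (-lam * t)
    generalize Real.exp (lam * t) = e at *
    generalize Real.exp (-lam * t) = e' at *
    have a1 : lam * (e * (α * ‖w t‖ ^ 2)) ≤ lam * (e * ⟪B t (w t), w t⟫) := by
      gcongr
      simpa using hco
    have a2 : |κ| * (e * ‖j (w t)‖ ^ 2) ≤ |κ| * (e * (‖j‖ ^ 2 * ‖w t‖ ^ 2)) := by gcongr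
    have a3 : (K + |κ| * ‖j‖ ^ 2 + 1) * (e * ‖w t‖ ^ 2) ≤ lam * α * (e * ‖w t‖ ^ 2) := by
      gcongr
    have a4 : (|κ| + 1) * (e' * ‖j (u t)‖ ^ 2) ≤ lam * (e' * ‖j (u t)‖ ^ 2) := by gcongr
    have a5 : 0 ≤ e * ‖w t‖ ^ 2 := by positivity
    rw [hZt]
    linarith
  have hZz : ∀ᵐ t ∂volume.restrict (Ioo 0 T), -Z t = 0 := by
    have hnn : 0 ≤ᵐ[volume.restrict (Ioo 0 T)] fun t => -Z t := by
      filter_upwards [hZle] with t ht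
      exact le_trans (by positivity) ht
    have hint := ((intervalIntegrable_iff_integrable_restrict_Ioo hT).1 iZ).neg
    refine (integral_eq_zero_iff_of_nonneg_ae hnn hint).1 (le_antisymm ?_ (integral_nonneg_of_ae hnn))
    rw [setIntegral_Ioo_eq_intervalIntegral hT, intervalIntegral.integral_neg]
    linarith
  filter_upwards [hZle, hZz] with t h1 h2
  rw [h2] at h1
  have h4 : ‖j (u t)‖ ^ 2 ≤ 0 := by
    by_contra h5
    exact absurd h1 (not_le.2 (mul_pos (Real.exp_pos _) (not_le.1 h5)))
  have := pow_eq_zero_iff two_ne_zero |>.1 (le_antisymm h4 (sq_nonneg _))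
  exact norm_eq_zero.1 this

end Mild

/-! ### Test functions, the trajectory space and coercivity. -/

section VariationalSolution

open Filter Topology

variable {V H : Type*} [NormedAddCommGroup V] [InnerProductSpace ℝ V] [CompleteSpace V]
  [NormedAddCommGroup H] [InnerProductSpace ℝ H] [CompleteSpace H]

local notation "⟪" x ", " y "⟫" => inner ℝ x y

theorem memLp_two_of_continuous {E : Type*} [NormedAddCommGroup E] {g : ℝ → E} (hg : Continuous g)
    (T : ℝ) : MemLp g 2 (volume.restrict (Ioo 0 T)) := by
  obtain ⟨C, hC⟩ := (isCompact_Icc (a := (0 : ℝ)) (b := T)).exists_bound_of_continuousOn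
    hg.continuousOn
  refine MemLp.of_bound hg.aestronglyMeasurable C ?_
  filter_upwards [ae_restrict_mem measurableSet_Ioo] with t ht using hC t (Ioo_subset_Icc_self ht)

/-- Restriction of continuous functions to `L²(0,T)`. -/
noncomputable def continuousToL2 {E : Type*} [NormedAddCommGroup E] [NormedSpace ℝ E] (T : ℝ) :
    C(ℝ, E) →ₗ[ℝ] L2 T E where
  toFun g := (memLp_two_of_continuous g.continuous T).toLp g
  map_add' _ _ := rfl
  map_smul' _ _ := rfl

theorem inner_continuousToL2 {T : ℝ} (g : C(ℝ, V)) (k : L2 T V) :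
    ⟪continuousToL2 T g, k⟫ = ∫ t in Ioo 0 T, ⟪g t, k t⟫ := by
  rw [L2.inner_def]
  refine integral_congr_ae ?_
  filter_upwards [(memLp_two_of_continuous g.continuous T).coeFn_toLp] with t ht
  exact congrArg (fun z => ⟪z, k t⟫) ht

theorem inner_continuousToL2' {T : ℝ} (g k : C(ℝ, V)) :
    ⟪continuousToL2 T g, continuousToL2 T k⟫ = ∫ t in Ioo 0 T, ⟪g t, k t⟫ := by
  rw [inner_continuousToL2]
  refine integral_congr_ae ?_
  filter_upwards [(memLp_two_of_continuous k.continuous T).coeFn_toLp] with t ht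
  exact congrArg (fun z => ⟪g t, z⟫) ht

/-- Pointwise application of a continuous family of operators. -/
noncomputable def applyFamily {E F : Type*} [NormedAddCommGroup E] [NormedSpace ℝ E]
    [NormedAddCommGroup F] [NormedSpace ℝ F] (L : C(ℝ, E →L[ℝ] F)) : C(ℝ, E) →ₗ[ℝ] C(ℝ, F) where
  toFun g := ⟨fun t => L t (g t), L.continuous.clm_apply g.continuous⟩
  map_add' _ _ := by ext; simp
  map_smul' _ _ := by ext; simp

variable (V) in
/-- Twice continuously differentiable functions, together with their derivatives, whose first
derivative vanishes at `T`. -/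
def testSpace (T : ℝ) : Submodule ℝ ((ℝ → V) × (ℝ → V) × (ℝ → V)) where
  carrier := {w | (∀ t, HasDerivAt w.1 (w.2.1 t) t) ∧ (∀ t, HasDerivAt w.2.1 (w.2.2 t) t) ∧
    Continuous w.2.2 ∧ w.2.1 T = 0}
  add_mem' := fun h k => ⟨fun t => (h.1 t).add (k.1 t), fun t => (h.2.1 t).add (k.2.1 t),
    h.2.2.1.add k.2.2.1, by simp [h.2.2.2, k.2.2.2]⟩
  zero_mem' := ⟨fun t => hasDerivAt_const t 0, fun t => hasDerivAt_const t 0, continuous_const, rfl⟩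
  smul_mem' := fun c _ h => ⟨fun t => (h.1 t).const_smul c, fun t => (h.2.1 t).const_smul c,
    h.2.2.1.const_smul c, by simp [h.2.2.2]⟩

theorem continuous_of_hasDerivAt {E : Type*} [NormedAddCommGroup E] [NormedSpace ℝ E]
    {g g' : ℝ → E} (h : ∀ t, HasDerivAt g (g' t) t) :
    Continuous g := continuous_iff_continuousAt.2 fun t => (h t).continuousAt

/-- The values of a test function. -/
def testVal (T : ℝ) : testSpace V T →ₗ[ℝ] C(ℝ, V) where
  toFun w := ⟨w.1.1, continuous_of_hasDerivAt w.2.1⟩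
  map_add' _ _ := rfl
  map_smul' _ _ := rfl

/-- The first derivative of a test function. -/
def testDeriv (T : ℝ) : testSpace V T →ₗ[ℝ] C(ℝ, V) where
  toFun w := ⟨w.1.2.1, continuous_of_hasDerivAt w.2.2.1⟩
  map_add' _ _ := rfl
  map_smul' _ _ := rfl

/-- The second derivative of a test function. -/
def testDeriv₂ (T : ℝ) : testSpace V T →ₗ[ℝ] C(ℝ, V) where
  toFun w := ⟨w.1.2.2, w.2.2.2.1⟩
  map_add' _ _ := rfl
  map_smul' _ _ := rfl

/-- Evaluation of a continuous function. -/
def evalAt {E : Type*} [NormedAddCommGroup E] [NormedSpace ℝ E] (t : ℝ) : C(ℝ, E) →ₗ[ℝ] E where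
  toFun g := g t
  map_add' _ _ := rfl
  map_smul' _ _ := rfl

variable (V H) in
/-- The Hilbert space `L²(0,T;V) × L²(0,T;H) × V × V`. -/
abbrev TrajectorySpace (T : ℝ) := WithLp 2 (WithLp 2 (L2 T V × L2 T H) × WithLp 2 (V × V))

/-- Combine linear maps into the components of `TrajectorySpace`. -/
noncomputable def trajectoryMap {W : Type*} [AddCommGroup W] [Module ℝ W] {T : ℝ} (a : W →ₗ[ℝ] L2 T V)
    (b : W →ₗ[ℝ] L2 T H) (c d : W →ₗ[ℝ] V) : W →ₗ[ℝ] TrajectorySpace V H T where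
  toFun w := WithLp.toLp 2 (WithLp.toLp 2 (a w, b w), WithLp.toLp 2 (c w, d w))
  map_add' _ _ := by simp only [map_add]; rfl
  map_smul' _ _ := by simp only [map_smul]; rfl

theorem inner_trajectory {T : ℝ} (a a' : L2 T V) (b b' : L2 T H) (c d c' d' : V) :
    ⟪(WithLp.toLp 2 (WithLp.toLp 2 (a, b), WithLp.toLp 2 (c, d)) : TrajectorySpace V H T),
      WithLp.toLp 2 (WithLp.toLp 2 (a', b'), WithLp.toLp 2 (c', d'))⟫ =
      ⟪a, a'⟫ + ⟪b, b'⟫ + (⟪c, c'⟫ + ⟪d, d'⟫) := by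
  simp only [WithLp.prod_inner_apply]

theorem eq_add_integral_of_hasDerivAt {E : Type*} [NormedAddCommGroup E] [NormedSpace ℝ E]
    [CompleteSpace E] {g g' : ℝ → E} (hg : ∀ t, HasDerivAt g (g' t) t) (hg' : Continuous g') (t : ℝ) :
    g t = g 0 + ∫ s in (0 : ℝ)..t, g' s := by
  rw [intervalIntegral.integral_eq_sub_of_hasDerivAt (fun s _ => hg s)
    (hg'.intervalIntegrable _ _)]
  abel

/-- Energy estimate for `w` with multiplier `exp (-lam t) w'`. Differentiating the weight produces
`lam` times the energy, which absorbs the Lipschitz term and the shift by `κ`. The initial term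
enters doubled on the right: one copy cancels the boundary term at `0` from the energy inequality,
the other controls `‖w 0‖²`. -/
theorem energy_coercive {j : V →L[ℝ] H} {A : ℝ → V →L[ℝ] V} {K α κ : ℝ}
    (hA : IsWaveFamily j A K α κ) {lam : ℝ} (hl1 : |κ| + 1 ≤ lam)
    (hl2 : K + |κ| * ‖j‖ ^ 2 + 1 ≤ lam * α) {T : ℝ} (hT : 0 ≤ T) {w w₁ w₂ : ℝ → V}
    (h1 : ∀ t, HasDerivAt w (w₁ t) t) (h2 : ∀ t, HasDerivAt w₁ (w₂ t) t) (hc : Continuous w₂)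
    (h0 : w₁ T = 0) :
    Real.exp (-lam * T) * (∫ t in (0 : ℝ)..T, (‖w t‖ ^ 2 + ‖j (w₁ t)‖ ^ 2)) +
      Real.exp (-lam * T) * (α * ‖w T‖ ^ 2) + α * ‖w 0‖ ^ 2 + ‖j (w₁ 0)‖ ^ 2 ≤
    2 * ((∫ t in (0 : ℝ)..T, (Real.exp (-lam * t) * ⟪A t (w₁ t), w t⟫ +
      Real.exp (-lam * t) * (lam * ‖j (w₁ t)‖ ^ 2 - ⟪j (w₂ t), j (w₁ t)⟫))) +
      ⟪A 0 (w 0) + κ • j.adjoint (j (w 0)), w 0⟫) := by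
  have hcm : Continuous fun t => Real.exp (-lam * t) :=
    Real.continuous_exp.comp (continuous_const.mul continuous_id)
  have hwc := continuous_of_hasDerivAt h1
  have hw₁c := continuous_of_hasDerivAt h2
  have hjw : ∀ t, HasDerivAt (fun t => j (w₁ t)) (j (w₂ t)) t := fun t =>
    j.hasFDerivAt.comp_hasDerivAt t (h2 t)
  set B : ℝ → V →L[ℝ] V := fun t => A t + κ • (j.adjoint ∘L j) with hB
  have hBf : IsWaveFamily j B K α 0 := hA.shift
  have hAc := hA.continuous
  have hBc := hBf.continuous
  -- With `-id` the boundary terms reduce to `‖j (w₁ 0)‖²`, because `w₁ T = 0`.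
  have e2 := energy_le (B := fun _ => -ContinuousLinearMap.id ℝ H) (K := 0) (by simp) (by simp)
    (hasDerivAt_exp_const_mul (-lam)) (continuous_const.mul hcm)
    (fun t => (Real.exp_pos _).le) hT ((j.continuous.comp hc).intervalIntegrable 0 T)
    (fun t => j (w₁ t)) (fun t _ => eq_add_integral_of_hasDerivAt hjw (j.continuous.comp hc) t)
  have e3 := energy_le hBf.lip hBf.symm (hasDerivAt_exp_const_mul (-lam)) (continuous_const.mul hcm)
    (fun t => (Real.exp_pos _).le) hT (hw₁c.intervalIntegrable 0 T) w (fun t _ => eq_add_integral_of_hasDerivAt h1 hw₁c t)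
  simp only [h0, map_zero, inner_zero_right, mul_zero, Real.exp_zero, one_mul, zero_sub, neg_apply,
    ContinuousLinearMap.id_apply, inner_neg_left, neg_neg, real_inner_self_eq_norm_sq, zero_mul,
    add_zero, Function.comp_apply] at e2 e3
  have hT1 := hBf.coercive T (w T)
  have h01 := hBf.coercive 0 (w 0)
  have hBA : ∀ t x, B t x = A t x + κ • j.adjoint (j x) := fun t x => rfl
  rw [← hBA]
  simp only [zero_mul, add_zero] at hT1 h01
  have hT2 := mul_le_mul_of_nonneg_left hT1 (Real.exp_pos (-lam * T)).le
  have hAw : Continuous fun t => A t (w₁ t) := hAc.clm_apply hw₁c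
  have hBw : Continuous fun t => B t (w t) := hBc.clm_apply hwc
  have hjc₁ : Continuous fun t => j (w₁ t) := j.continuous.comp hw₁c
  have hjc₂ : Continuous fun t => j (w₂ t) := j.continuous.comp hc
  have key : Real.exp (-lam * T) * (∫ t in (0 : ℝ)..T, (‖w t‖ ^ 2 + ‖j (w₁ t)‖ ^ 2)) ≤
      2 * (∫ t in (0 : ℝ)..T, (Real.exp (-lam * t) * ⟪A t (w₁ t), w t⟫ +
      Real.exp (-lam * t) * (lam * ‖j (w₁ t)‖ ^ 2 - ⟪j (w₂ t), j (w₁ t)⟫))) -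
      (∫ t in (0 : ℝ)..T, (-lam * Real.exp (-lam * t) * -‖j (w₁ t)‖ ^ 2 +
        2 * (Real.exp (-lam * t) * -⟪j (w₁ t), j (w₂ t)⟫))) -
      ∫ t in (0 : ℝ)..T, (-lam * Real.exp (-lam * t) * ⟪B t (w t), w t⟫ +
        2 * (Real.exp (-lam * t) * ⟪B t (w t), w₁ t⟫) + K * (Real.exp (-lam * t) * ‖w t‖ ^ 2)) := by
    rw [← intervalIntegral.integral_const_mul, ← intervalIntegral.integral_const_mul,
      ← intervalIntegral.integral_sub (Continuous.intervalIntegrable (by fun_prop) _ _)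
        (Continuous.intervalIntegrable (by fun_prop) _ _),
      ← intervalIntegral.integral_sub (Continuous.intervalIntegrable (by fun_prop) _ _)
        (Continuous.intervalIntegrable (by fun_prop) _ _)]
    refine intervalIntegral.integral_mono_on hT (Continuous.intervalIntegrable (by fun_prop) _ _)
      (Continuous.intervalIntegrable (by fun_prop) _ _) fun t ht => ?_
    have hlam : 0 ≤ lam := by linarith [abs_nonneg κ]
    -- The weight is smallest at `T`, whence the factor in front of the integral.
    have hee : Real.exp (-lam * T) ≤ Real.exp (-lam * t) := by
      rw [Real.exp_le_exp]; nlinarith [ht.2]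
    have hpos := Real.exp_pos (-lam * t)
    have hBu : ⟪B t (w t), w₁ t⟫ = ⟪A t (w₁ t), w t⟫ + κ * ⟪j (w t), j (w₁ t)⟫ := by
      rw [hBf.symm, real_inner_comm, hBA, inner_add_left, inner_smul_left,
        ContinuousLinearMap.adjoint_inner_left, real_inner_comm (j (w t))]
      rfl
    have hco := hBf.coercive t (w t)
    have hcr := two_mul_inner_le_weighted (κ := -κ) zero_le_one zero_le_one (one_mul 1)
      (j (w t)) (j (w₁ t))
    have hjw : ‖j (w t)‖ ^ 2 ≤ ‖j‖ ^ 2 * ‖w t‖ ^ 2 := by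
      rw [← mul_pow]; gcongr; exact j.le_opNorm _
    rw [abs_neg] at hcr
    have b1 : ‖w t‖ ^ 2 + ‖j (w₁ t)‖ ^ 2 ≤ lam * ‖j (w₁ t)‖ ^ 2 - 2 * κ * ⟪j (w t), j (w₁ t)⟫ +
        lam * ⟪B t (w t), w t⟫ - K * ‖w t‖ ^ 2 := by
      have a1 : lam * (α * ‖w t‖ ^ 2) ≤ lam * ⟪B t (w t), w t⟫ := by
        gcongr
        simpa using hco
      have a2 : |κ| * ‖j (w t)‖ ^ 2 ≤ |κ| * (‖j‖ ^ 2 * ‖w t‖ ^ 2) := by gcongr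
      have a3 : (K + |κ| * ‖j‖ ^ 2 + 1) * ‖w t‖ ^ 2 ≤ lam * α * ‖w t‖ ^ 2 := by gcongr
      have a4 : (|κ| + 1) * ‖j (w₁ t)‖ ^ 2 ≤ lam * ‖j (w₁ t)‖ ^ 2 := by gcongr
      linarith
    have b2 := mul_le_mul_of_nonneg_left b1 hpos.le
    have b3 : Real.exp (-lam * T) * (‖w t‖ ^ 2 + ‖j (w₁ t)‖ ^ 2) ≤
      Real.exp (-lam * t) * (‖w t‖ ^ 2 + ‖j (w₁ t)‖ ^ 2) := by gcongr
    refine b3.trans (b2.trans_eq ?_)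
    rw [hBu, real_inner_comm (j (w₁ t)) (j (w₂ t))]
    ring
  linarith

end VariationalSolution

/-! ### Existence for the variational problem. -/

section Existence

open Filter Topology

variable {V H : Type*} [NormedAddCommGroup V] [InnerProductSpace ℝ V] [CompleteSpace V]
  [NormedAddCommGroup H] [InnerProductSpace ℝ H] [CompleteSpace H]

local notation "⟪" x ", " y "⟫" => inner ℝ x y

/-- Existence of a solution of the variational problem. The traces at `0` and `T` are independent
components, tied to `u` and `p` by the relations satisfied by smooth functions. -/
theorem exists_variational_solution {j : V →L[ℝ] H} {A : ℝ → V →L[ℝ] V} {K α κ : ℝ}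
    (hA : IsWaveFamily j A K α κ) {T : ℝ} (hT : 0 ≤ T) (u₀ : V) (u₁ : H) {f : ℝ → H}
    (hf : MemLp f 2 (volume.restrict (Ioo 0 T))) :
    ∃ (lam : ℝ) (u : L2 T V) (p : L2 T H) (x y : V),
      (∀ (ζ : C(ℝ, V)) (η : C(ℝ, H)) (a b : V),
        (∀ w w₁ : ℝ → V, (∀ t, HasDerivAt w (w₁ t) t) → Continuous w₁ →
          (∫ t in Ioo 0 T, ⟪ζ t, w t⟫) + (∫ t in Ioo 0 T, ⟪η t, j (w₁ t)⟫) +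
            (⟪a, w 0⟫ + ⟪b, w T⟫) = 0) →
        (∫ t in Ioo 0 T, ⟪ζ t, u t⟫) + (∫ t in Ioo 0 T, ⟪η t, p t⟫) + (⟪a, x⟫ + ⟪b, y⟫) = 0) ∧
      ∀ w w₁ w₂ : ℝ → V, (∀ t, HasDerivAt w (w₁ t) t) → (∀ t, HasDerivAt w₁ (w₂ t) t) →
        Continuous w₂ → w₁ T = 0 →
        (∫ t in Ioo 0 T, ⟪Real.exp (-lam * t) • A t (w₁ t), u t⟫) +
          (∫ t in Ioo 0 T, ⟪Real.exp (-lam * t) • (lam • j (w₁ t) - j (w₂ t)), p t⟫) +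
          ⟪A 0 (w 0) + κ • j.adjoint (j (w 0)), x⟫ =
        (∫ t in Ioo 0 T, ⟪Real.exp (-lam * t) • j (w₁ t), f t⟫) + ⟪u₁, j (w₁ 0)⟫ +
          ⟪A 0 u₀ + κ • j.adjoint (j u₀), w 0⟫ := by
  obtain ⟨lam, hl1, hl2⟩ := hA.exists_weight
  have hlam : 0 ≤ lam := by linarith [abs_nonneg κ]
  have hAc := hA.continuous
  have hcm : Continuous fun t => Real.exp (-lam * t) :=
    Real.continuous_exp.comp (continuous_const.mul continuous_id)
  set B₀ : V →L[ℝ] V := A 0 + κ • (j.adjoint ∘L j) with hB₀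
  let jc : C(ℝ, V →L[ℝ] H) := ⟨fun _ => j, continuous_const⟩
  let ejc : C(ℝ, V →L[ℝ] H) := ⟨fun t => Real.exp (-lam * t) • j, hcm.smul continuous_const⟩
  let eAc : C(ℝ, V →L[ℝ] V) := ⟨fun t => Real.exp (-lam * t) • A t, hcm.smul hAc⟩
  let W := testSpace V T
  let q : W →ₗ[ℝ] L2 T H := continuousToL2 T ∘ₗ applyFamily jc ∘ₗ testDeriv T
  let ι : W →ₗ[ℝ] TrajectorySpace V H T := trajectoryMap (continuousToL2 T ∘ₗ testVal T) q
    (evalAt 0 ∘ₗ testVal T) (evalAt T ∘ₗ testVal T)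
  let b : W →ₗ[ℝ] C(ℝ, H) := applyFamily ejc ∘ₗ (lam • testDeriv T - testDeriv₂ T)
  -- Comes from testing with `exp (-lam t) w₁` and moving the time derivative onto it: `-(exp (-lam
  -- t) w₁)' = exp (-lam t) (lam w₁ - w₂)`. The component `B₀ (w 0)` supplies coercivity at time `0`
  -- and encodes the initial value.
  let Φ : W →ₗ[ℝ] TrajectorySpace V H T :=
    trajectoryMap (continuousToL2 T ∘ₗ applyFamily eAc ∘ₗ testDeriv T) (continuousToL2 T ∘ₗ b)
      (B₀.toLinearMap ∘ₗ evalAt 0 ∘ₗ testVal T) 0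
  have hef : MemLp (fun t => Real.exp (-lam * t) • f t) 2 (volume.restrict (Ioo 0 T)) := by
    refine hf.of_le (hcm.aestronglyMeasurable.smul hf.aestronglyMeasurable) ?_
    filter_upwards [ae_restrict_mem measurableSet_Ioo] with t ht
    rw [norm_smul, Real.norm_eq_abs, abs_of_pos (Real.exp_pos _)]
    refine mul_le_of_le_one_left (norm_nonneg _) (Real.exp_le_one_iff.2 ?_)
    nlinarith [ht.1]
  let F : L2 T H := hef.toLp
  let j0 : W →ₗ[ℝ] H := j.toLinearMap ∘ₗ evalAt 0 ∘ₗ testDeriv T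
  let l : W →ₗ[ℝ] ℝ := (innerSL ℝ F).toLinearMap ∘ₗ q + (innerSL ℝ u₁).toLinearMap ∘ₗ j0 +
    (innerSL ℝ (B₀ u₀)).toLinearMap ∘ₗ evalAt 0 ∘ₗ testVal T
  -- The functional `l` contains `⟪u₁, j (w₁ 0)⟫`, which `‖ι w‖` does not control, so the initial
  -- velocity is added to the norm.
  let N : W → ℝ := fun w => √(‖ι w‖ ^ 2 + ‖j0 w‖ ^ 2)
  have hιsq : ∀ w : W, ‖ι w‖ ^ 2 = ‖continuousToL2 T (testVal T w)‖ ^ 2 + ‖q w‖ ^ 2 +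
      (‖w.1.1 0‖ ^ 2 + ‖w.1.1 T‖ ^ 2) := fun w => by
    rw [← real_inner_self_eq_norm_sq]
    refine (inner_trajectory _ _ _ _ _ _ _ _).trans ?_
    simp only [real_inner_self_eq_norm_sq]
    rfl
  have hN : ∀ w, ‖ι w‖ ≤ N w := fun w => Real.le_sqrt_of_sq_le (by linarith [sq_nonneg ‖j0 w‖])
  have hl : ∀ w, |l w| ≤ (‖F‖ + ‖u₁‖ + ‖B₀ u₀‖) * N w := fun w => by
    have s1 := sq_nonneg ‖continuousToL2 T (testVal T w)‖
    have s2 := sq_nonneg ‖j0 w‖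
    have s3 := sq_nonneg ‖w.1.1 0‖
    have s4 := sq_nonneg ‖w.1.1 T‖
    have s5 := sq_nonneg ‖q w‖
    have h1 : ‖q w‖ ≤ N w := Real.le_sqrt_of_sq_le (by rw [hιsq]; linarith)
    have h2 : ‖j0 w‖ ≤ N w := Real.le_sqrt_of_sq_le (by linarith [sq_nonneg ‖ι w‖])
    have h3 : ‖w.1.1 0‖ ≤ N w := Real.le_sqrt_of_sq_le (by rw [hιsq]; linarith)
    have h4 : l w = ⟪F, q w⟫ + ⟪u₁, j0 w⟫ + ⟪B₀ u₀, w.1.1 0⟫ := rfl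
    rw [h4, add_mul, add_mul]
    refine (abs_add_three _ _ _).trans (add_le_add_three ?_ ?_ ?_)
    · exact (abs_real_inner_le_norm _ _).trans (by gcongr)
    · exact (abs_real_inner_le_norm _ _).trans (by gcongr)
    · exact (abs_real_inner_le_norm _ _).trans (by gcongr)
  -- The constant is a common lower bound for the coefficients in `energy_coercive`, halved for the
  -- factor `2` on its right-hand side.
  have hΦι : ∀ w, Real.exp (-lam * T) * min 1 α / 2 * N w ^ 2 ≤ ⟪Φ w, ι w⟫ := fun w => by
    have h1 := w.2.1
    have h2 := w.2.2.1
    have hc := w.2.2.2.1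
    have hw₁c := continuous_of_hasDerivAt h2
    have hwc := continuous_of_hasDerivAt h1
    have hjc₁ : Continuous fun t => j (w.1.2.1 t) := j.continuous.comp hw₁c
    have hjc₂ : Continuous fun t => j (w.1.2.2 t) := j.continuous.comp hc
    have hAw : Continuous fun t => A t (w.1.2.1 t) := hAc.clm_apply hw₁c
    have key := energy_coercive hA hl1 hl2 hT h1 h2 hc w.2.2.2.2
    have e1 : ⟪Φ w, ι w⟫ = (∫ t in (0 : ℝ)..T, (Real.exp (-lam * t) * ⟪A t (w.1.2.1 t), w.1.1 t⟫ +
        Real.exp (-lam * t) * (lam * ‖j (w.1.2.1 t)‖ ^ 2 - ⟪j (w.1.2.2 t), j (w.1.2.1 t)⟫))) +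
        ⟪A 0 (w.1.1 0) + κ • j.adjoint (j (w.1.1 0)), w.1.1 0⟫ := by
      refine (inner_trajectory _ _ _ _ _ _ _ _).trans ?_
      rw [intervalIntegral.integral_add (Continuous.intervalIntegrable (by fun_prop) _ _)
        (Continuous.intervalIntegrable (by fun_prop) _ _)]
      congr 1
      · congr 1
        · refine (inner_continuousToL2' _ _).trans ?_
          rw [setIntegral_Ioo_eq_intervalIntegral hT]
          refine intervalIntegral.integral_congr fun t _ => ?_
          exact real_inner_smul_left _ _ _
        · refine (inner_continuousToL2' _ _).trans ?_
          rw [setIntegral_Ioo_eq_intervalIntegral hT]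
          refine intervalIntegral.integral_congr fun t _ => ?_
          change ⟪Real.exp (-lam * t) • j (lam • w.1.2.1 t - w.1.2.2 t), j (w.1.2.1 t)⟫ = _
          rw [real_inner_smul_left, map_sub, map_smul, inner_sub_left, real_inner_smul_left,
            real_inner_self_eq_norm_sq]
      · simp only [LinearMap.zero_apply, inner_zero_left, add_zero]
        rfl
    have e2 : ‖continuousToL2 T (testVal T w)‖ ^ 2 + ‖q w‖ ^ 2 =
        ∫ t in (0 : ℝ)..T, (‖w.1.1 t‖ ^ 2 + ‖j (w.1.2.1 t)‖ ^ 2) := by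
      rw [intervalIntegral.integral_add (Continuous.intervalIntegrable (by fun_prop) _ _)
        (Continuous.intervalIntegrable (by fun_prop) _ _), ← real_inner_self_eq_norm_sq,
        ← real_inner_self_eq_norm_sq, inner_continuousToL2']
      refine congrArg₂ _ ?_ ((inner_continuousToL2' _ _).trans ?_)
      · rw [setIntegral_Ioo_eq_intervalIntegral hT]
        exact intervalIntegral.integral_congr fun t _ => real_inner_self_eq_norm_sq _
      · rw [setIntegral_Ioo_eq_intervalIntegral hT]
        exact intervalIntegral.integral_congr fun t _ => real_inner_self_eq_norm_sq _
    rw [e1, Real.sq_sqrt (by positivity), hιsq, e2]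
    have hm1 : Real.exp (-lam * T) ≤ 1 := Real.exp_le_one_iff.2 (by nlinarith)
    have hm0 := Real.exp_pos (-lam * T)
    have hα0 : 0 ≤ min 1 α := le_min zero_le_one hA.pos.le
    have hα1 : min 1 α ≤ 1 := min_le_left _ _
    have hαα : min 1 α ≤ α := min_le_right _ _
    have hI : 0 ≤ ∫ t in (0 : ℝ)..T, (‖w.1.1 t‖ ^ 2 + ‖j (w.1.2.1 t)‖ ^ 2) :=
      intervalIntegral.integral_nonneg hT fun _ _ => by positivity
    have hj0 : j0 w = j (w.1.2.1 0) := rfl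
    rw [hj0]
    generalize (∫ t in (0 : ℝ)..T, (‖w.1.1 t‖ ^ 2 + ‖j (w.1.2.1 t)‖ ^ 2)) = I at *
    generalize Real.exp (-lam * T) = m at *
    have a1 : m * min 1 α * I ≤ m * I := by
      have := mul_le_mul_of_nonneg_left hα1 (mul_nonneg hm0.le hI)
      linarith
    have a2 : m * min 1 α * ‖w.1.1 T‖ ^ 2 ≤ m * (α * ‖w.1.1 T‖ ^ 2) := by
      rw [mul_assoc]; gcongr
    have a3 : m * min 1 α * ‖w.1.1 0‖ ^ 2 ≤ α * ‖w.1.1 0‖ ^ 2 := by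
      gcongr
      exact (mul_le_of_le_one_left hα0 hm1).trans hαα
    have a4 : m * min 1 α * ‖j (w.1.2.1 0)‖ ^ 2 ≤ ‖j (w.1.2.1 0)‖ ^ 2 :=
      mul_le_of_le_one_left (sq_nonneg _) ((mul_le_of_le_one_left hα0 hm1).trans hα1)
    linarith
  obtain ⟨U, hU, hUl⟩ := exists_mem_closure_range_inner_eq ι Φ l N
    (div_pos (mul_pos (Real.exp_pos (-lam * T)) (lt_min one_pos hA.pos)) two_pos)
    (by positivity) hN hl hΦι
  refine ⟨lam, U.fst.fst, U.fst.snd, U.snd.fst, U.snd.snd, fun ζ η a b' hz => ?_,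
    fun w w₁ w₂ h1 h2 hc h0 => ?_⟩
  · have := inner_eq_zero_of_mem_closure_range ι hU (ξ := WithLp.toLp 2
      (WithLp.toLp 2 (continuousToL2 T ζ, continuousToL2 T η), WithLp.toLp 2 (a, b'))) fun w => by
      refine (inner_trajectory _ _ _ _ _ _ _ _).trans ?_
      refine Eq.trans ?_ (hz w.1.1 w.1.2.1 w.2.1 (continuous_of_hasDerivAt w.2.2.1))
      exact congrArg₂ _ (congrArg₂ _ (inner_continuousToL2' _ _) (inner_continuousToL2' _ _)) rfl
    have e1 : ⟪continuousToL2 T ζ, U.fst.fst⟫ + ⟪continuousToL2 T η, U.fst.snd⟫ +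
        (⟪a, U.snd.fst⟫ + ⟪b', U.snd.snd⟫) = 0 :=
      (inner_trajectory _ _ _ _ _ _ _ _).symm.trans this
    rwa [inner_continuousToL2, inner_continuousToL2] at e1
  · have := hUl ⟨(w, w₁, w₂), h1, h2, hc, h0⟩
    let wt : W := ⟨(w, w₁, w₂), h1, h2, hc, h0⟩
    have e1 : ⟪continuousToL2 T (applyFamily eAc (testDeriv T wt)), U.fst.fst⟫ +
        ⟪continuousToL2 T (b wt), U.fst.snd⟫ + (⟪B₀ (w 0), U.snd.fst⟫ + ⟪(0 : V), U.snd.snd⟫) =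
        ⟪F, q wt⟫ + ⟪u₁, j (w₁ 0)⟫ + ⟪B₀ u₀, w 0⟫ :=
      (inner_trajectory _ _ _ _ _ _ _ _).symm.trans this
    rw [inner_continuousToL2, inner_continuousToL2, inner_zero_left, add_zero,
      real_inner_comm (q wt)] at e1
    have e2 : ⟪q wt, F⟫ = ∫ t in Ioo 0 T, ⟪Real.exp (-lam * t) • j (w₁ t), f t⟫ := by
      refine (inner_continuousToL2 _ _).trans (integral_congr_ae ?_)
      filter_upwards [hef.coeFn_toLp] with t ht
      refine (congrArg (fun z => ⟪j (w₁ t), z⟫) ht).trans ?_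
      rw [inner_smul_right, real_inner_smul_left]
    have e3 : ∫ t in Ioo 0 T, ⟪Real.exp (-lam * t) • (lam • j (w₁ t) - j (w₂ t)), U.fst.snd t⟫ =
        ∫ t in Ioo 0 T, ⟪b wt t, U.fst.snd t⟫ := by
      refine integral_congr_ae (ae_of_all _ fun t => ?_)
      have : b wt t = Real.exp (-lam * t) • j (lam • w₁ t - w₂ t) := rfl
      simp only [this, map_sub, map_smul]
    rw [e3, ← e2]
    exact e1

end Existence

/-! ### Mild solutions: existence, uniqueness and values in `V`. -/

section MildExistence

open Filter Topology

variable {V H : Type*} [NormedAddCommGroup V] [InnerProductSpace ℝ V] [CompleteSpace V]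
  [NormedAddCommGroup H] [InnerProductSpace ℝ H] [CompleteSpace H]

local notation "⟪" x ", " y "⟫" => inner ℝ x y

theorem setIntegral_Ioo_inner {E : Type*} [NormedAddCommGroup E] [InnerProductSpace ℝ E]
    [CompleteSpace E] {T : ℝ} (hT : 0 ≤ T) {g : ℝ → E}
    (hg : IntervalIntegrable g volume 0 T) (h : E) :
    ∫ t in Ioo 0 T, ⟪h, g t⟫ = ⟪h, ∫ t in (0 : ℝ)..T, g t⟫ := by
  rw [← setIntegral_Ioo_eq_intervalIntegral hT]
  exact integral_inner ((intervalIntegrable_iff_integrable_restrict_Ioo hT).1 hg) h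

/-- Integration by parts against the antiderivative of `η` which vanishes at `T`. -/
theorem integral_antideriv_smul {E : Type*} [NormedAddCommGroup E] [NormedSpace ℝ E]
    [CompleteSpace E] {T : ℝ} (hT : 0 ≤ T) {η : ℝ → ℝ} (hη : Continuous η) {g : ℝ → E}
    (hg : IntervalIntegrable g volume 0 T) (c : E) :
    (∫ t in (0 : ℝ)..T, η t • (c + ∫ s in (0 : ℝ)..t, g s)) +
      ∫ t in (0 : ℝ)..T, (-(∫ s in (0 : ℝ)..T, η s) + ∫ s in (0 : ℝ)..t, η s) • g t =
    (∫ s in (0 : ℝ)..T, η s) • c := by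
  refine (integral_bilin_primitive (ContinuousLinearMap.lsmul ℝ ℝ (E := E)) hT
    (hη.intervalIntegrable 0 T) hg (-(∫ s in (0 : ℝ)..T, η s)) c).trans ?_
  simp

/-- The closure relations of the variational solution yield the first identity and the terminal
trace; its equation yields the initial value and the second identity. That `y` lies in `V` is what
later places the continuous representative in `V`. -/
theorem exists_mildSolution {j : V →L[ℝ] H} {A : ℝ → V →L[ℝ] V} {K α κ : ℝ}
    (hA : IsWaveFamily j A K α κ) {T : ℝ} (hT : 0 ≤ T) (u₀ : V) (u₁ : H) {f : ℝ → H}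
    (hf : MemLp f 2 (volume.restrict (Ioo 0 T))) :
    ∃ (u : L2 T V) (p : L2 T H) (y : V), IsMildSolution j A T u₀ u₁ f u p ∧
      j y = j u₀ + ∫ s in (0 : ℝ)..T, p s := by
  obtain ⟨lam, u, p, x, y, hcl, heq⟩ := exists_variational_solution hA hT u₀ u₁ hf
  have hu := MemLp.intervalIntegrable_Ioo hT (Lp.memLp u)
  have hp := MemLp.intervalIntegrable_Ioo hT (Lp.memLp p)
  have hfi := MemLp.intervalIntegrable_Ioo hT hf
  have hAu := hA.intervalIntegrable_apply hT hu
  have hjf : IntervalIntegrable (fun t => j.adjoint (f t)) volume 0 T :=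
    (intervalIntegrable_iff_integrable_restrict_Ioo hT).2
      (j.adjoint.integrable_comp ((intervalIntegrable_iff_integrable_restrict_Ioo hT).1 hfi))
  have hju : IntervalIntegrable (fun t => j (u t)) volume 0 T :=
    (intervalIntegrable_iff_integrable_restrict_Ioo hT).2
      (j.integrable_comp ((intervalIntegrable_iff_integrable_restrict_Ioo hT).1 hu))
  have hjp : IntervalIntegrable (fun t => j.adjoint (p t)) volume 0 T :=
    (intervalIntegrable_iff_integrable_restrict_Ioo hT).2
      (j.adjoint.integrable_comp ((intervalIntegrable_iff_integrable_restrict_Ioo hT).1 hp))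
  -- The constant test function `x - u₀` kills every term except the initial one, and the shifted
  -- operator at `0` is coercive.
  have hx : x = u₀ := by
    have h1 := heq (fun _ => x - u₀) (fun _ => 0) (fun _ => 0) (fun t => hasDerivAt_const t _)
      (fun t => hasDerivAt_const t _) continuous_const rfl
    simp only [map_zero, smul_zero, inner_zero_left, integral_zero, sub_self, inner_zero_right,
      zero_add] at h1
    have h2 := hA.shift.coercive 0 (x - u₀)
    have h3 := hA.shift.symm 0 (x - u₀) u₀
    have h4 : ⟪A 0 (x - u₀) + κ • j.adjoint (j (x - u₀)), x - u₀⟫ = 0 := by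
      rw [inner_sub_right, h1, sub_eq_zero, real_inner_comm]
      exact h3.symm
    have h5 : α * ‖x - u₀‖ ^ 2 ≤ 0 := by
      refine h2.trans_eq ?_
      rw [zero_mul, add_zero]; exact h4
    have h6 : ‖x - u₀‖ ^ 2 ≤ 0 := by
      by_contra h7
      exact absurd h5 (not_le.2 (mul_pos hA.pos (not_le.1 h7)))
    exact sub_eq_zero.1 (norm_eq_zero.1
      ((pow_eq_zero_iff two_ne_zero).1 (le_antisymm h6 (sq_nonneg _))))
  subst hx
  have hy : j y = j x + ∫ s in (0 : ℝ)..T, p s := by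
    refine ext_inner_left ℝ fun h => ?_
    have := hcl 0 (ContinuousMap.const ℝ h) (j.adjoint h) (-j.adjoint h) fun w w₁ hw hw₁ => by
      have hjw : ∀ t, HasDerivAt (fun t => j (w t)) (j (w₁ t)) t := fun t =>
        j.hasFDerivAt.comp_hasDerivAt t (hw t)
      have hc : Continuous fun t => j (w₁ t) := j.continuous.comp hw₁
      simp only [ContinuousMap.zero_apply, inner_zero_left, integral_zero, ContinuousMap.const_apply]
      rw [setIntegral_Ioo_inner hT (hc.intervalIntegrable 0 T), inner_neg_left,
        ContinuousLinearMap.adjoint_inner_left, ContinuousLinearMap.adjoint_inner_left,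
        eq_add_integral_of_hasDerivAt hjw hc T, inner_add_right]
      ring
    simp only [ContinuousMap.zero_apply, inner_zero_left, integral_zero,
      ContinuousMap.const_apply] at this
    rw [setIntegral_Ioo_inner hT hp, inner_neg_left, ContinuousLinearMap.adjoint_inner_left,
      ContinuousLinearMap.adjoint_inner_left] at this
    rw [inner_add_right]
    linarith
  refine ⟨u, p, y, ⟨Lp.memLp u, Lp.memLp p, ?_, ?_⟩, hy⟩
  · set q : ℝ → H := fun t => j x + ∫ s in (0 : ℝ)..t, p s with hq
    have hqi : IntervalIntegrable q volume 0 T := ContinuousOn.intervalIntegrable (by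
      rw [uIcc_of_le hT]; exact continuousOn_primitive_Icc hT hp _)
    have := ae_eq_zero_of_integral_test hT (hju.sub hqi) fun η hη _ _ => by
      have hηc := hη.continuous
      set χ : ℝ → ℝ := fun t => -(∫ s in (0 : ℝ)..T, η s) + ∫ s in (0 : ℝ)..t, η s with hχ
      have hχc : Continuous χ := continuous_const.add
        (intervalIntegral.continuous_primitive (fun _ _ => hηc.intervalIntegrable _ _) 0)
      have hηu := hju.continuousOn_smul (hηc.continuousOn (s := uIcc 0 T))
      have hηq := hqi.continuousOn_smul (hηc.continuousOn (s := uIcc 0 T))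
      have hχp := hp.continuousOn_smul (hχc.continuousOn (s := uIcc 0 T))
      have hby := integral_antideriv_smul hT hηc hp (j x)
      rw [setIntegral_Ioo_eq_intervalIntegral hT]
      simp only [smul_sub]
      rw [intervalIntegral.integral_sub hηu hηq, sub_eq_zero]
      refine ext_inner_left ℝ fun h => ?_
      -- For smooth `w` this relation is integration by parts of `j w` against `χ`, the
      -- antiderivative of `η` with `χ T = 0`.
      have h1 := hcl ⟨fun t => η t • j.adjoint h, hηc.smul continuous_const⟩
        ⟨fun t => χ t • h, hχc.smul continuous_const⟩ (-(∫ s in (0 : ℝ)..T, η s) • j.adjoint h) 0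
      simp only [ContinuousMap.coe_mk, real_inner_smul_left, ContinuousLinearMap.adjoint_inner_left,
        inner_zero_left, add_zero] at h1
      simp only [← real_inner_smul_right] at h1
      have h2 := h1 fun w w₁ hw hw₁ => by
        have hjw : ∀ t, HasDerivAt (fun t => j (w t)) (j (w₁ t)) t := fun t =>
          j.hasFDerivAt.comp_hasDerivAt t (hw t)
        have hc : Continuous fun t => j (w₁ t) := j.continuous.comp hw₁
        have hcw : Continuous fun t => j (w t) := continuous_of_hasDerivAt hjw
        have := integral_antideriv_smul hT hηc (hc.intervalIntegrable 0 T) (j (w 0))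
        simp only [← eq_add_integral_of_hasDerivAt hjw hc] at this
        rw [setIntegral_Ioo_inner hT ((hηc.fun_smul hcw).intervalIntegrable 0 T),
          setIntegral_Ioo_inner hT ((hχc.fun_smul hc).intervalIntegrable 0 T), ← inner_add_right, this,
          ← inner_add_right]
        simp
      rw [setIntegral_Ioo_inner hT hηu, setIntegral_Ioo_inner hT hχp] at h2
      have h3 := congrArg (fun z => ⟪h, z⟫) hby
      simp only [inner_add_right] at h3
      simp only [neg_smul, inner_neg_right] at h2
      linarith
    filter_upwards [this] with t ht
    exact sub_eq_zero.1 ht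
  · set g : ℝ → V := fun t => j.adjoint (f t) - A t (u t) with hg
    have hgi : IntervalIntegrable g volume 0 T := hjf.sub hAu
    set q : ℝ → V := fun t => j.adjoint u₁ + ∫ s in (0 : ℝ)..t, g s with hq
    have hqi : IntervalIntegrable q volume 0 T := ContinuousOn.intervalIntegrable (by
      rw [uIcc_of_le hT]; exact continuousOn_primitive_Icc hT hgi _)
    have := ae_eq_zero_of_integral_test hT (hjp.sub hqi) fun η hη _ _ => by
      have hηc := hη.continuous
      set χ : ℝ → ℝ := fun t => -(∫ s in (0 : ℝ)..T, η s) + ∫ s in (0 : ℝ)..t, η s with hχ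
      have hχd : ∀ t, HasDerivAt χ (η t) t := fun t =>
        (hηc.integral_hasStrictDerivAt 0 t).hasDerivAt.const_add _
      have hχc : Continuous χ := continuous_of_hasDerivAt hχd
      have hηp := hjp.continuousOn_smul (hηc.continuousOn (s := uIcc 0 T))
      have hηq := hqi.continuousOn_smul (hηc.continuousOn (s := uIcc 0 T))
      have hχg := hgi.continuousOn_smul (hχc.continuousOn (s := uIcc 0 T))
      have hχf := hjf.continuousOn_smul (hχc.continuousOn (s := uIcc 0 T))
      have hχA := hAu.continuousOn_smul (hχc.continuousOn (s := uIcc 0 T))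
      have hby := integral_antideriv_smul hT hηc hgi (j.adjoint u₁)
      rw [setIntegral_Ioo_eq_intervalIntegral hT]
      simp only [smul_sub]
      rw [intervalIntegral.integral_sub hηp hηq, sub_eq_zero]
      refine ext_inner_left ℝ fun v => ?_
      set e : ℝ → ℝ := fun t => Real.exp (lam * t) with he
      have hed : ∀ t, HasDerivAt e (lam * e t) t := hasDerivAt_exp_const_mul lam
      have hec := continuous_of_hasDerivAt hed
      have hw₁ : ∀ t, HasDerivAt (fun t => (e t * χ t) • v)
          ((lam * e t * χ t + e t * η t) • v) t := fun t => ((hed t).mul (hχd t)).smul_const v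
      have hw₁c := continuous_of_hasDerivAt hw₁
      -- The factor `e` cancels the exponential weight, `w 0 = 0` removes the initial term, and `χ T
      -- = 0` makes the test function admissible.
      have h1 := heq (fun t => ∫ s in (0 : ℝ)..t, (e s * χ s) • v) _ _
        (fun t => (hw₁c.integral_hasStrictDerivAt 0 t).hasDerivAt) hw₁
        (by fun_prop) (by simp [hχ])
      have hee : ∀ t, Real.exp (-lam * t) * e t = 1 := fun t => by
        rw [he, ← Real.exp_add]; simp
      have s1 : ∀ t, Real.exp (-lam * t) • A t ((e t * χ t) • v) = χ t • A t v := fun t => by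
        rw [map_smul, smul_smul, ← mul_assoc, hee, one_mul]
      have s2 : ∀ t, Real.exp (-lam * t) • (lam • j ((e t * χ t) • v) -
          j ((lam * e t * χ t + e t * η t) • v)) = -(η t • j v) := fun t => by
        rw [map_smul, map_smul, smul_smul, ← sub_smul, smul_smul, ← neg_smul]
        congr 1
        linear_combination (-η t) * hee t
      have s3 : ∀ t, Real.exp (-lam * t) • j ((e t * χ t) • v) = χ t • j v := fun t => by
        rw [map_smul, smul_smul, ← mul_assoc, hee, one_mul]
      simp only [s1, s2, s3, intervalIntegral.integral_same, map_zero, smul_zero, add_zero,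
        inner_zero_left, inner_zero_right, inner_neg_left, real_inner_smul_left, hA.symm,
        ← ContinuousLinearMap.adjoint_inner_right] at h1
      simp only [← real_inner_smul_right] at h1
      have h2 : ⟪u₁, j ((e 0 * χ 0) • v)⟫ = -⟪v, (∫ s in (0 : ℝ)..T, η s) • j.adjoint u₁⟫ := by
        rw [real_inner_smul_right, ContinuousLinearMap.adjoint_inner_right, map_smul,
          real_inner_smul_right, real_inner_comm]
        simp [he, hχ]
      have h3 := congrArg (fun z => ⟪v, z⟫) hby
      have h4 : ∫ t in (0 : ℝ)..T, χ t • g t = (∫ t in (0 : ℝ)..T, χ t • j.adjoint (f t)) -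
          ∫ t in (0 : ℝ)..T, χ t • A t (u t) := by
        rw [← intervalIntegral.integral_sub hχf hχA]
        simp only [hg, smul_sub]
      rw [integral_neg, setIntegral_Ioo_inner hT hχA, setIntegral_Ioo_inner hT hηp,
        setIntegral_Ioo_inner hT hχf, h2] at h1
      have h5 := congrArg (fun z => ⟪v, z⟫) h4
      simp only [inner_add_right, inner_sub_right] at h3 h5
      linarith
    filter_upwards [this] with t ht
    exact sub_eq_zero.1 ht

/-- By linearity the difference solves the homogeneous problem. -/
theorem IsMildSolution.ae_eq {j : V →L[ℝ] H} {A : ℝ → V →L[ℝ] V} {K α κ : ℝ}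
    (hA : IsWaveFamily j A K α κ) {T : ℝ} (hT : 0 ≤ T) {u₀ : V} {u₁ : H} {f : ℝ → H}
    (hf : MemLp f 2 (volume.restrict (Ioo 0 T))) {u u' : ℝ → V} {p p' : ℝ → H}
    (h : IsMildSolution j A T u₀ u₁ f u p) (h' : IsMildSolution j A T u₀ u₁ f u' p') :
    ∀ᵐ t ∂volume.restrict (Ioo 0 T), j (u t) = j (u' t) := by
  have hp := MemLp.intervalIntegrable_Ioo hT h.memLp_snd
  have hp' := MemLp.intervalIntegrable_Ioo hT h'.memLp_snd
  have hAu := hA.intervalIntegrable_apply hT (MemLp.intervalIntegrable_Ioo hT h.memLp_fst)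
  have hAu' := hA.intervalIntegrable_apply hT (MemLp.intervalIntegrable_Ioo hT h'.memLp_fst)
  have hjf : IntervalIntegrable (fun t => j.adjoint (f t)) volume 0 T :=
    (intervalIntegrable_iff_integrable_restrict_Ioo hT).2
      (j.adjoint.integrable_comp (hf.integrable one_le_two))
  have h0 : 0 ∈ Icc 0 T := left_mem_Icc.2 hT
  have hd : IsMildSolution j A T 0 0 0 (fun t => u t - u' t) (fun t => p t - p' t) := by
    refine ⟨h.memLp_fst.sub h'.memLp_fst, h.memLp_snd.sub h'.memLp_snd, ?_, ?_⟩
    · filter_upwards [h.first, h'.first, ae_restrict_mem measurableSet_Ioo] with t h1 h2 ht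
      have ht' := Ioo_subset_Icc_self ht
      rw [map_sub, h1, h2, intervalIntegral.integral_sub (IntervalIntegrable.mono_Icc hT hp h0 ht')
        (IntervalIntegrable.mono_Icc hT hp' h0 ht'), map_zero]
      abel
    · filter_upwards [h.second, h'.second, ae_restrict_mem measurableSet_Ioo] with t h1 h2 ht
      have ht' := Ioo_subset_Icc_self ht
      rw [map_sub, h1, h2, add_sub_add_left_eq_sub, ← intervalIntegral.integral_sub
        (IntervalIntegrable.mono_Icc hT (hjf.sub hAu) h0 ht')
        (IntervalIntegrable.mono_Icc hT (hjf.sub hAu') h0 ht'), map_zero, zero_add]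
      refine intervalIntegral.integral_congr fun s _ => ?_
      simp
  filter_upwards [hd.ae_eq_zero hA hT] with t ht
  rwa [map_sub, sub_eq_zero] at ht

theorem restrict_Ioo_mono {s T : ℝ} (hsT : s ≤ T) :
    (volume.restrict (Ioo 0 s) : Measure ℝ) ≤ volume.restrict (Ioo 0 T) :=
  Measure.restrict_mono (Ioo_subset_Ioo_right hsT) le_rfl

theorem IsMildSolution.mono {j : V →L[ℝ] H} {A : ℝ → V →L[ℝ] V} {s T : ℝ} (hsT : s ≤ T)
    {u₀ : V} {u₁ : H} {f : ℝ → H} {u : ℝ → V} {p : ℝ → H}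
    (h : IsMildSolution j A T u₀ u₁ f u p) : IsMildSolution j A s u₀ u₁ f u p :=
  ⟨h.memLp_fst.mono_measure (restrict_Ioo_mono hsT), h.memLp_snd.mono_measure (restrict_Ioo_mono hsT),
    ae_mono (restrict_Ioo_mono hsT) h.first, ae_mono (restrict_Ioo_mono hsT) h.second⟩

/-- The continuous representative of a mild solution takes its values in `V`. -/
theorem IsMildSolution.primitive_mem_range {j : V →L[ℝ] H} {A : ℝ → V →L[ℝ] V} {K α κ : ℝ}
    (hA : IsWaveFamily j A K α κ) {T : ℝ} {u₀ : V} {u₁ : H} {f : ℝ → H}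
    (hf : MemLp f 2 (volume.restrict (Ioo 0 T))) {u : ℝ → V} {p : ℝ → H}
    (h : IsMildSolution j A T u₀ u₁ f u p) {s : ℝ} (hs : s ∈ Icc 0 T) :
    j u₀ + ∫ t in (0 : ℝ)..s, p t ∈ range j := by
  rcases hs.1.eq_or_lt with rfl | hs0
  · exact ⟨u₀, by simp⟩
  have hfs := hf.mono_measure (restrict_Ioo_mono hs.2)
  have hu := h.mono hs.2
  -- A fresh solution on `[0,s]` has a terminal trace `y` in `V`; by uniqueness on `(0,s)` and
  -- continuity, both primitives agree at `s`.
  obtain ⟨u', p', y, hu', hy⟩ := exists_mildSolution hA hs0.le u₀ u₁ hfs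
  have hae := hu.ae_eq hA hs0.le hfs hu'
  have := eqOn_Icc_of_ae_eq_Ioo hs0
    (continuousOn_primitive_Icc hs0.le (MemLp.intervalIntegrable_Ioo hs0.le hu.memLp_snd) (j u₀))
    (continuousOn_primitive_Icc hs0.le (MemLp.intervalIntegrable_Ioo hs0.le hu'.memLp_snd) (j u₀))
    (by
      filter_upwards [hae, hu.first, hu'.first] with t h1 h2 h3
      rw [← h2, ← h3, h1]) (right_mem_Icc.2 hs0.le)
  exact ⟨y, hy.trans this.symm⟩

end MildExistence

/-! ### Transfer between `V'` over `𝕜` and the real Hilbert space `V`. -/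

section Transfer

variable {𝕜 V H : Type*} [RCLike 𝕜]
  [NormedAddCommGroup V] [InnerProductSpace 𝕜 V] [CompleteSpace V]
  [NormedAddCommGroup H] [InnerProductSpace 𝕜 H] [CompleteSpace H]
  [InnerProductSpace ℝ V] [IsScalarTower ℝ 𝕜 V] [InnerProductSpace ℝ H] [IsScalarTower ℝ 𝕜 H]

variable (𝕜) in
/-- The Riesz map `V → V'`, as a real-linear map. -/
noncomputable def rieszMap (V : Type*) [NormedAddCommGroup V] [InnerProductSpace 𝕜 V]
    [NormedSpace ℝ V] [IsScalarTower ℝ 𝕜 V] : V →L[ℝ] AntiDual 𝕜 V :=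
  LinearMap.mkContinuous
    { toFun := fun x => innerSLFlip 𝕜 x
      map_add' := fun x y => map_add _ x y
      map_smul' := fun r x => by
        ext v
        have : r • x = (r : 𝕜) • x := by rw [← algebraMap_smul 𝕜 r x]
        simp only [this, innerSLFlip_apply_apply, inner_smul_right, RingHom.id_apply]
        change _ = r • inner 𝕜 v x
        rw [RCLike.real_smul_eq_coe_mul] } 1 (fun x => by
    rw [one_mul]
    refine ContinuousLinearMap.opNorm_le_bound _ (norm_nonneg _) fun v => ?_
    rw [mul_comm]
    exact norm_inner_le_norm v x)

theorem rieszMap_apply (x v : V) : rieszMap 𝕜 V x v = inner 𝕜 v x := rfl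

theorem rieszMap_injective : Function.Injective (rieszMap 𝕜 V) := fun _ _ h =>
  ext_inner_left 𝕜 fun v => DFunLike.congr_fun h v

variable {T : ℝ}

/-- The operator on `V` representing the form `a(t,·,·)`, constant outside `[0,T]`. -/
noncomputable def rieszOp {a : Icc (0 : ℝ) T → V →ₗ[𝕜] V →ₗ⋆[𝕜] 𝕜} (ha : IsVBounded a) (hT : 0 ≤ T)
    (t : ℝ) : V →L[ℝ] V :=
  (InnerProductSpace.continuousLinearMapOfBilin
    (formOp ha (projIcc 0 T hT t)).flip).restrictScalars ℝ

theorem inner_rieszOp {a : Icc (0 : ℝ) T → V →ₗ[𝕜] V →ₗ⋆[𝕜] 𝕜} (ha : IsVBounded a) (hT : 0 ≤ T)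
    (t : ℝ) (x y : V) : inner 𝕜 (rieszOp ha hT t x) y = a (projIcc 0 T hT t) y x :=
  InnerProductSpace.continuousLinearMapOfBilin_apply _ x y

/-- The Riesz operator is built from the flipped form; symmetry undoes the exchange of arguments
after conjugation. -/
theorem rieszMap_rieszOp {a : Icc (0 : ℝ) T → V →ₗ[𝕜] V →ₗ⋆[𝕜] 𝕜} (ha : IsVBounded a)
    (hs : IsSymmetricForm a) (hT : 0 ≤ T) (t : ℝ) (x : V) :
    rieszMap 𝕜 V (rieszOp ha hT t x) = formOp ha (projIcc 0 T hT t) x := by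
  ext v
  rw [rieszMap_apply, ← inner_conj_symm, inner_rieszOp, formOp_apply, hs _ x v]

theorem isWaveFamily_rieszOp (hV : ∀ x y : V, inner ℝ x y = RCLike.re (inner 𝕜 x y))
    {j : V →L[𝕜] H} {a : Icc (0 : ℝ) T → V →ₗ[𝕜] V →ₗ⋆[𝕜] 𝕜} (ha : IsVBounded a) (hT : 0 ≤ T)
    (hs : IsSymmetricForm a) {K α κ : ℝ}
    (hK : ∀ (t s : Icc (0 : ℝ) T) (u v : V),
      ‖a t u v - a s u v‖ ≤ K * |(t : ℝ) - s| * ‖u‖ * ‖v‖) (hα : 0 < α)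
    (hc : ∀ (t : Icc (0 : ℝ) T) (u : V), α * ‖u‖ ^ 2 ≤ RCLike.re (a t u u) + κ * ‖j u‖ ^ 2) :
    IsWaveFamily (j.restrictScalars ℝ) (rieszOp ha hT) |K| α κ where
  lip s t := by
    refine ContinuousLinearMap.opNorm_le_bound _ (by positivity) fun x => ?_
    set y := (rieszOp ha hT s - rieszOp ha hT t) x with hy
    have h1 : ∀ z, inner 𝕜 y z = a (projIcc 0 T hT s) z x - a (projIcc 0 T hT t) z x := fun z => by
      rw [hy, sub_apply, inner_sub_left, inner_rieszOp, inner_rieszOp]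
    -- The form difference is tested with `y` itself. The absolute value appears because `K` is not
    -- assumed non-negative.
    have h2 : ‖y‖ * ‖y‖ ≤ |K| * |s - t| * ‖x‖ * ‖y‖ := by
      rw [← inner_self_eq_norm_mul_norm (𝕜 := 𝕜)]
      calc RCLike.re (inner 𝕜 y y) ≤ ‖inner 𝕜 y y‖ := RCLike.re_le_norm _
        _ ≤ K * |(projIcc 0 T hT s : ℝ) - projIcc 0 T hT t| * ‖y‖ * ‖x‖ := by
          rw [h1]; exact hK _ _ y x
        _ ≤ |K| * |s - t| * ‖y‖ * ‖x‖ := by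
          have := abs_projIcc_sub_projIcc hT (c := s) (d := t)
          gcongr
          exact le_abs_self K
        _ = _ := by ring
    rcases (norm_nonneg y).eq_or_lt with h3 | h3
    · rw [← h3]; positivity
    · exact le_of_mul_le_mul_right h2 h3
  symm t x y := by
    rw [hV, hV, inner_rieszOp, ← inner_conj_symm, inner_rieszOp, hs]
  pos := hα
  coercive t x := by
    rw [hV, inner_rieszOp]
    exact hc _ x

/-- The real and the `𝕜`-linear adjoints of `j` coincide, since the real inner products are real
parts. -/
theorem rieszMap_adjoint (hV : ∀ x y : V, inner ℝ x y = RCLike.re (inner 𝕜 x y))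
    (hH : ∀ x y : H, inner ℝ x y = RCLike.re (inner 𝕜 x y)) (j : V →L[𝕜] H) (h : H) :
    rieszMap 𝕜 V ((j.restrictScalars ℝ).adjoint h) = toAntiDual j h := by
  have h1 : (j.restrictScalars ℝ).adjoint h = j.adjoint h := by
    refine ext_inner_left ℝ fun v => ?_
    rw [ContinuousLinearMap.adjoint_inner_right, hV, hH, ContinuousLinearMap.adjoint_inner_right]
    rfl
  ext v
  rw [h1, rieszMap_apply, toAntiDual_apply, ContinuousLinearMap.adjoint_inner_right]

theorem IsWaveFamily.memLp_apply {V H : Type*} [NormedAddCommGroup V] [InnerProductSpace ℝ V]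
    [CompleteSpace V] [NormedAddCommGroup H] [InnerProductSpace ℝ H] [CompleteSpace H]
    {j : V →L[ℝ] H} {A : ℝ → V →L[ℝ] V} {K α κ : ℝ}
    (hA : IsWaveFamily j A K α κ) {u : ℝ → V}
    (hu : MemLp u 2 (volume.restrict (Ioo 0 T))) :
    MemLp (fun t => A t (u t)) 2 (volume.restrict (Ioo 0 T)) := by
  obtain ⟨C, -, hC⟩ := exists_bound_of_continuousOn (T := T) hA.continuous.continuousOn
  refine hu.of_le_mul (c := C) ?_ ?_
  · exact (ContinuousLinearMap.id ℝ (V →L[ℝ] V)).aestronglyMeasurable_comp₂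
      hA.continuous.aestronglyMeasurable hu.aestronglyMeasurable
  · filter_upwards [ae_restrict_mem measurableSet_Ioo] with t ht
    exact ((A t).le_opNorm _).trans (by gcongr; exact hC t (Ioo_subset_Icc_self ht))

/-- The second-order equation and its initial value, in integrated form. -/
theorem exists_second_weakDeriv_iff (hV : ∀ x y : V, inner ℝ x y = RCLike.re (inner 𝕜 x y))
    (hH : ∀ x y : H, inner ℝ x y = RCLike.re (inner 𝕜 x y)) {j : V →L[𝕜] H} (hT : 0 < T)
    {a : Icc (0 : ℝ) T → V →ₗ[𝕜] V →ₗ⋆[𝕜] 𝕜} (ha : IsVBounded a) (hs : IsSymmetricForm a)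
    {K α κ : ℝ} (hA : IsWaveFamily (j.restrictScalars ℝ) (rieszOp ha hT.le) K α κ)
    (f : L2 T H) (u : L2 T V) (p : L2 T H) (u₁ : H) :
    (∃ u'' : L2 T (AntiDual 𝕜 V), IsWeakDeriv T (fun t => toAntiDual j (p t)) u'' ∧
      (∀ᵐ t : ℝ, ∀ ht : t ∈ Ioo 0 T,
        u'' t + formOp ha ⟨t, Ioo_subset_Icc_self ht⟩ (u t) = toAntiDual j (f t)) ∧
      HasInitialValue T (fun t => toAntiDual j (p t)) (toAntiDual j u₁)) ↔
    ∀ᵐ t ∂volume.restrict (Ioo 0 T), (j.restrictScalars ℝ).adjoint (p t) =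
      (j.restrictScalars ℝ).adjoint u₁ +
        ∫ s in (0 : ℝ)..t, ((j.restrictScalars ℝ).adjoint (f s) - rieszOp ha hT.le s (u s)) := by
  set J := (j.restrictScalars ℝ).adjoint with hJ
  have hRJ : ∀ h, rieszMap 𝕜 V (J h) = toAntiDual j h := rieszMap_adjoint hV hH j
  set g : ℝ → V := fun s => J (f s) - rieszOp ha hT.le s (u s) with hg
  have hgL : MemLp g 2 (volume.restrict (Ioo 0 T)) :=
    (J.comp_memLp' (Lp.memLp f)).sub (hA.memLp_apply (Lp.memLp u))
  have hRgL : MemLp (fun t => rieszMap 𝕜 V (g t)) 2 (volume.restrict (Ioo 0 T)) :=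
    (rieszMap 𝕜 V).comp_memLp' hgL
  have hgi := MemLp.intervalIntegrable_Ioo hT.le hgL
  have hRgi := MemLp.intervalIntegrable_Ioo hT.le hRgL
  have hRg : ∀ t (ht : t ∈ Ioo 0 T), rieszMap 𝕜 V (g t) =
      toAntiDual j (f t) - formOp ha ⟨t, Ioo_subset_Icc_self ht⟩ (u t) := fun t ht => by
    rw [hg, map_sub, hRJ, rieszMap_rieszOp ha hs, projIcc_of_mem]
  have hRint : ∀ t ∈ Icc 0 T, rieszMap 𝕜 V (J u₁ + ∫ s in (0 : ℝ)..t, g s) =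
      toAntiDual j u₁ + ∫ s in (0 : ℝ)..t, rieszMap 𝕜 V (g s) := fun t ht => by
    rw [map_add, hRJ, ContinuousLinearMap.intervalIntegral_comp_comm _
      (IntervalIntegrable.mono_Icc hT.le hgi (left_mem_Icc.2 hT.le) ht)]
  have hpL : MemLp (fun t => toAntiDual j (p t)) 2 (volume.restrict (Ioo 0 T)) := by
    have := (rieszMap 𝕜 V).comp_memLp' (J.comp_memLp' (Lp.memLp p))
    exact this.ae_eq (ae_of_all _ fun t => hRJ (p t))
  constructor
  · rintro ⟨u'', hw, heq, hi⟩
    have h1 := hw.ae_eq_primitive_of_initialValue hT (MemLp.intervalIntegrable_Ioo hT.le hpL)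
      (MemLp.intervalIntegrable_Ioo hT.le (Lp.memLp u'')) hi
    filter_upwards [h1, ae_restrict_mem measurableSet_Ioo] with t ht htm
    refine rieszMap_injective (𝕜 := 𝕜) ?_
    rw [hRint t (Ioo_subset_Icc_self htm), hRJ, ht]
    congr 1
    refine intervalIntegral.integral_congr_ae ?_
    filter_upwards [heq] with s hs' hst
    rw [uIoc_of_le htm.1.le] at hst
    have hsm : s ∈ Ioo 0 T := ⟨hst.1, hst.2.trans_lt htm.2⟩
    rw [hRg s hsm, ← hs' hsm, add_sub_cancel_right]
  · intro h
    have hp : ∀ᵐ t ∂volume.restrict (Ioo 0 T), toAntiDual j (p t) =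
        toAntiDual j u₁ + ∫ s in (0 : ℝ)..t, rieszMap 𝕜 V (g s) := by
      filter_upwards [h, ae_restrict_mem measurableSet_Ioo] with t ht htm
      rw [← hRint t (Ioo_subset_Icc_self htm), ← ht, hRJ]
    -- The equation forces the second derivative to be `f - 𝒜 u`, which is the Riesz image of `g`.
    refine ⟨hRgL.toLp, ?_, ?_, hasInitialValue_of_ae_eq_primitive hT hRgi hp⟩
    · intro φ h1 h2 h3
      rw [isWeakDeriv_of_ae_eq_primitive hT hRgi _ hp φ h1 h2 h3]
      congr 1
      refine integral_congr_ae ?_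
      filter_upwards [hRgL.coeFn_toLp] with t ht
      rw [ht]
    · have := (ae_restrict_iff' measurableSet_Ioo).1 hRgL.coeFn_toLp
      filter_upwards [this] with t ht htm
      rw [ht htm, hRg t htm, sub_add_cancel]

/-- The first-order relation between `u` and `u̇`, in integrated form. -/
theorem first_weakDeriv_iff {j : V →L[𝕜] H} (hT : 0 < T) (u : L2 T V) (p : L2 T H) (u₀ : V) :
    (IsWeakDeriv T (fun t => j (u t)) p ∧ HasInitialValue T (fun t => j (u t)) (j u₀)) ↔
    ∀ᵐ t ∂volume.restrict (Ioo 0 T), j (u t) = j u₀ + ∫ s in (0 : ℝ)..t, p s := by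
  have hp := MemLp.intervalIntegrable_Ioo hT.le (Lp.memLp p)
  refine ⟨fun h => ?_, fun h => ⟨isWeakDeriv_of_ae_eq_primitive hT hp _ h,
    hasInitialValue_of_ae_eq_primitive hT hp h⟩⟩
  exact h.1.ae_eq_primitive_of_initialValue hT (MemLp.intervalIntegrable_Ioo hT.le
    (j.comp_memLp' (Lp.memLp u))) hp h.2

end Transfer

end WaveMR

/-! ### Well-posedness of the wave equation. -/

theorem mainTheorem4 {𝕜 V H : Type*} [RCLike 𝕜]
    [NormedAddCommGroup V] [InnerProductSpace 𝕜 V] [CompleteSpace V]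
    [TopologicalSpace.SeparableSpace V]
    [NormedAddCommGroup H] [InnerProductSpace 𝕜 H] [CompleteSpace H]
    [TopologicalSpace.SeparableSpace H]
    (j : V →L[𝕜] H) (hj_inj : Function.Injective j) (hj_dense : DenseRange j)
    {T : ℝ} (hT : 0 < T)
    (a : Icc (0 : ℝ) T → V →ₗ[𝕜] V →ₗ⋆[𝕜] 𝕜)
    (ha : WaveMR.IsVBounded a)
    (ha_coercive : WaveMR.IsQuasiCoercive j a)
    (ha_symm : WaveMR.IsSymmetricForm a)
    (ha_lip : WaveMR.IsLipschitzForm a)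
    (u₀ : V) (u₁ : H) (f : WaveMR.L2 T H) :
    (∃! u : WaveMR.L2 T V, WaveMR.IsWaveSolution j ha f u₀ u₁ u) ∧
      ∀ u : WaveMR.L2 T V, WaveMR.IsWaveSolution j ha f u₀ u₁ u →
        ∀ U : ℝ → H, WaveMR.IsContRep T (fun t => j (u t)) U →
          ∀ t ∈ Icc 0 T, U t ∈ Set.range j := by
  let _ : InnerProductSpace ℝ V := InnerProductSpace.rclikeToReal 𝕜 V
  let _ : InnerProductSpace ℝ H := InnerProductSpace.rclikeToReal 𝕜 H
  have _ : IsScalarTower ℝ 𝕜 V := RestrictScalars.isScalarTower ℝ 𝕜 V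
  have _ : IsScalarTower ℝ 𝕜 H := RestrictScalars.isScalarTower ℝ 𝕜 H
  obtain ⟨α, hα, κ, hc⟩ := ha_coercive
  obtain ⟨K, hK⟩ := ha_lip
  have hV : ∀ x y : V, inner ℝ x y = RCLike.re (inner 𝕜 x y) := fun _ _ => rfl
  have hH : ∀ x y : H, inner ℝ x y = RCLike.re (inner 𝕜 x y) := fun _ _ => rfl
  have hA := WaveMR.isWaveFamily_rieszOp hV ha hT.le ha_symm hK hα hc
  -- Weak and mild solutions coincide, so existence, uniqueness and values in `V` can all be read
  -- off from the mild formulation.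
  have hiff : ∀ u : WaveMR.L2 T V, WaveMR.IsWaveSolution j ha f u₀ u₁ u ↔
      ∃ p : WaveMR.L2 T H, WaveMR.IsMildSolution (j.restrictScalars ℝ)
        (WaveMR.rieszOp ha hT.le) T u₀ u₁ f u p := fun u => by
    constructor
    · rintro ⟨p, u'', hd, heq, h0, h1⟩
      exact ⟨p, Lp.memLp u, Lp.memLp p,
        (WaveMR.first_weakDeriv_iff hT u p u₀).1 ⟨hd.first, h0⟩,
        (WaveMR.exists_second_weakDeriv_iff hV hH hT ha ha_symm hA f u p u₁).1
          ⟨u'', hd.second, heq, h1⟩⟩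
    · rintro ⟨p, hp⟩
      obtain ⟨hd, h0⟩ := (WaveMR.first_weakDeriv_iff hT u p u₀).2 hp.first
      obtain ⟨u'', hd', heq, h1⟩ :=
        (WaveMR.exists_second_weakDeriv_iff hV hH hT ha ha_symm hA f u p u₁).2 hp.second
      exact ⟨p, u'', ⟨hd, hd'⟩, heq, h0, h1⟩
  refine ⟨?_, fun u hu U hU t ht => ?_⟩
  · obtain ⟨u, p, -, hup, -⟩ := WaveMR.exists_mildSolution hA hT.le u₀ u₁ (Lp.memLp f)
    refine ⟨u, (hiff u).2 ⟨p, hup⟩, fun u' hu' => Lp.ext ?_⟩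
    obtain ⟨p', hp'⟩ := (hiff u').1 hu'
    filter_upwards [hp'.ae_eq hA hT.le (Lp.memLp f) hup] with t ht
    exact hj_inj ht
  · obtain ⟨p, hp⟩ := (hiff u).1 hu
    have := WaveMR.eqOn_Icc_of_ae_eq_Ioo hT hU.1 (WaveMR.continuousOn_primitive_Icc hT.le
      (WaveMR.MemLp.intervalIntegrable_Ioo hT.le hp.memLp_snd) (j u₀)) (hU.2.trans hp.first) ht
    rw [this]
    exact hp.primitive_mem_range hA (Lp.memLp f) ht
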